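/- Let $Y$ be a smooth $7$-manifold with a torsion-free $G_2$ structure: an admissible $3$-form $\varphi$, with associated Riemannian metric $k$ and dual $4$-form $*\varphi$, such that $d\varphi=0$ and $d{*}\varphi=0$. Let $V$ be a nowhere vanishing smooth vector field on $Y$ with $\mathcal L_V\varphi=0$, and let $\pi:Y\to N$ be a quotient of $Y$ by $V$, that is, a smooth surjective submersion onto a smooth $6$-manifold $N$ with $\ker d\pi_y=\mathbb R V_y$ for every $y\in Y$ (locally, $N$ is the space of orbits of $V$). Suppose that $N$ carries the structure induced by $\varphi$ and $V$: a smooth positive function $t$ with $t\circ\pi=k(V,V)^{-1/2}$, a $2$-form $\sigma$ with $\pi^*\sigma=\iota_V\varphi$, a Riemannian metric $h$ such that $k(v,w)=(t\circ\pi)\,h(d\pi\, v,d\pi\, w)$ for all tangent vectors $v,w$ orthogonal to $V$, and the almost-complex structure $J$ defined by $h(J\cdot,\cdot)=\sigma$. Assume that $J$ is integrable, so that $(N,h,J,\sigma)$ is a Kähler manifold. Let $U$ be the Hamiltonian vector field on $(N,\sigma)$ corresponding to $-t$, that is, $\iota_U\sigma=-dt$. Then $U$ has a unique horizontal lift $\widehat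 U$ to $Y$ (the vector field with $d\pi(\widehat U)=U\circ\pi$ and $k(\widehat U,V)=0$), $\widehat U$ is smooth, and it is an infinitesimal isometry of the $G_2$ structure that commutes with $V$: $$\mathcal L_{\widehat U}\varphi=0,\qquad \mathcal L_{\widehat U}k=0,\qquad [\widehat U,V]=0 .$$ Moreover $V$ and $\widehat U$ are linearly independent at every point $y$ with $dt_{\pi(y)}\neq0$. Thus the Kähler assumption yields an infinitesimal (local) $\mathbb T^2$ symmetry of $(Y,\varphi)$, generated by the commuting infinitesimal automorphisms $V$ and $\widehat U$. -/

import Mathlib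

open scoped Manifold ContDiff Bundle

noncomputable section

/-! ### Tensor calculus on a manifold modelled on a finite-dimensional space -/

section Calculus

variable (E : Type*) [NormedAddCommGroup E] [NormedSpace ℝ E]
variable (M : Type*) [TopologicalSpace M] [ChartedSpace E M]

/-- Vector fields on `M` (no smoothness included). -/
abbrev VField : Type _ := ∀ x : M, TangentSpace 𝓘(ℝ, E) x

/-- Differential `k`-forms on `M` (no smoothness included). -/
abbrev DForm (k : ℕ) : Type _ := ∀ x : M, (TangentSpace 𝓘(ℝ, E) x) [⋀^Fin k]→L[ℝ] ℝ

/-- Fields of endomorphisms of the tangent spaces of `M` (no smoothness included). -/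
abbrev EndoField : Type _ :=
  ∀ x : M, TangentSpace 𝓘(ℝ, E) x →L[ℝ] TangentSpace 𝓘(ℝ, E) x

variable {E M}

/-- Smoothness of a vector field at (that is, near) a point, as a section of the tangent bundle. -/
def VField.SmoothAt [IsManifold 𝓘(ℝ, E) ∞ M] (X : VField E M) (x : M) : Prop :=
  ContMDiffAt 𝓘(ℝ, E) 𝓘(ℝ, E).tangent ∞ (fun z => (⟨z, X z⟩ : TangentBundle 𝓘(ℝ, E) M)) x

/-- A smooth vector field. -/
def VField.Smooth [IsManifold 𝓘(ℝ, E) ∞ M] (X : VField E M) : Prop := ∀ x : M, X.SmoothAt x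

/-- The expression of the form `α` in the chart around `x₀`: the pullback of `α` by the
inverse of the chart. -/
def DForm.inChart {k : ℕ} (α : DForm E M k) (x₀ : M) (z : E) : E [⋀^Fin k]→L[ℝ] ℝ :=
  ContinuousAlternatingMap.compContinuousLinearMap (α ((extChartAt 𝓘(ℝ, E) x₀).symm z))
    (mfderiv 𝓘(ℝ, E) 𝓘(ℝ, E) (extChartAt 𝓘(ℝ, E) x₀).symm z)

/-- A smooth form: it is smooth in every chart of the family of preferred charts. -/
def DForm.Smooth {k : ℕ} (α : DForm E M k) : Prop :=
  ∀ x₀ : M, ContDiffOn ℝ ∞ (α.inChart x₀) (extChartAt 𝓘(ℝ, E) x₀).target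

/-- A closed form, `dα = 0`: the exterior derivative vanishes in every chart. -/
def DForm.Closed {k : ℕ} (α : DForm E M k) : Prop :=
  ∀ x₀ : M, ∀ z ∈ (extChartAt 𝓘(ℝ, E) x₀).target, extDeriv (α.inChart x₀) z = 0

/-- A smooth field of endomorphisms, as a section of the bundle `Hom(TM, TM)`. -/
def EndoField.Smooth [IsManifold 𝓘(ℝ, E) ∞ M] (J : EndoField E M) : Prop :=
  ContMDiff 𝓘(ℝ, E) (𝓘(ℝ, E).prod 𝓘(ℝ, E →L[ℝ] E)) ∞
    (fun x => Bundle.TotalSpace.mk' (E →L[ℝ] E)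
      (E := fun x : M => TangentSpace 𝓘(ℝ, E) x →L[ℝ] TangentSpace 𝓘(ℝ, E) x) x (J x))

/-- The derivative at `x` of the real function `f` in the direction `v`. -/
def dirDeriv (f : M → ℝ) (x : M) (v : TangentSpace 𝓘(ℝ, E) x) : ℝ :=
  mfderiv 𝓘(ℝ, E) 𝓘(ℝ, ℝ) f x v

/-- The value at `x` of `(L_X α)(Y₁, …, Yₖ)`, the Lie derivative of a form, that is, of
`X (α(Y₁, …, Yₖ)) - ∑ᵢ α(Y₁, …, [X, Yᵢ], …, Yₖ)`. -/
def DForm.lieDerivative {k : ℕ} (X : VField E M) (α : DForm E M k) (Y : Fin k → VField E M)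
    (x : M) : ℝ :=
  dirDeriv (fun z => α z (fun i => Y i z)) x (X x)
    - ∑ i, α x (Function.update (fun j => Y j x) i
        (VectorField.mlieBracket 𝓘(ℝ, E) X (Y i) x))

/-- `L_X α = 0`. -/
def DForm.IsPreservedBy [IsManifold 𝓘(ℝ, E) ∞ M] {k : ℕ} (α : DForm E M k) (X : VField E M) : Prop :=
  ∀ (x : M) (Y : Fin k → VField E M), (∀ i, (Y i).SmoothAt x) → α.lieDerivative X Y x = 0

/-- The Nijenhuis tensor `[JX, JY] - J[JX, Y] - J[X, JY] - [X, Y]` of an almost-complex structure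
vanishes. -/
def EndoField.NijenhuisZero [IsManifold 𝓘(ℝ, E) ∞ M] (J : EndoField E M) : Prop :=
  ∀ (x : M) (X Y : VField E M), X.SmoothAt x → Y.SmoothAt x →
    VectorField.mlieBracket 𝓘(ℝ, E) (fun z => J z (X z)) (fun z => J z (Y z)) x
      - J x (VectorField.mlieBracket 𝓘(ℝ, E) (fun z => J z (X z)) Y x)
      - J x (VectorField.mlieBracket 𝓘(ℝ, E) X (fun z => J z (Y z)) x)
      - VectorField.mlieBracket 𝓘(ℝ, E) X Y x = 0

variable (E M) in
/-- Smooth Riemannian metrics on `M`. -/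
abbrev RMetric [IsManifold 𝓘(ℝ, E) ∞ M] : Type _ :=
  Bundle.ContMDiffRiemannianMetric 𝓘(ℝ, E) ∞ E (fun x : M => TangentSpace 𝓘(ℝ, E) x)

/-- The scalar product `g(v, w)` of two tangent vectors. -/
def RMetric.ip [IsManifold 𝓘(ℝ, E) ∞ M] (g : RMetric E M) (x : M)
    (v w : TangentSpace 𝓘(ℝ, E) x) : ℝ :=
  Bundle.ContMDiffRiemannianMetric.inner g x v w

/-- `X` is a Killing vector field, `L_X g = 0`: for all locally defined smooth `Y`, `Z`,
`X (g(Y, Z)) = g([X, Y], Z) + g(Y, [X, Z])`. -/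
def RMetric.IsKilling [IsManifold 𝓘(ℝ, E) ∞ M] (g : RMetric E M) (X : VField E M) : Prop :=
  ∀ (x : M) (Y Z : VField E M), Y.SmoothAt x → Z.SmoothAt x →
    dirDeriv (fun z => g.ip z (Y z) (Z z)) x (X x)
      = g.ip x (VectorField.mlieBracket 𝓘(ℝ, E) X Y x) (Z x)
        + g.ip x (Y x) (VectorField.mlieBracket 𝓘(ℝ, E) X Z x)

/-- `(g, J, σ)` is a Kähler structure on `M`: `J` is an almost-complex structure, orthogonal for
the Riemannian metric `g`, `σ = g(J·, ·)` is the fundamental 2-form, `σ` is closed, and `J` is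
integrable. -/
structure IsKaehler [IsManifold 𝓘(ℝ, E) ∞ M] (g : RMetric E M) (J : EndoField E M)
    (σ : DForm E M 2) : Prop where
  smooth_J : J.Smooth
  smooth_form : σ.Smooth
  sq : ∀ x v, J x (J x v) = -v
  orthogonal : ∀ x v w, g.ip x (J x v) (J x w) = g.ip x v w
  form_eq : ∀ x v w, σ x ![v, w] = g.ip x (J x v) w
  closed : σ.Closed
  integrable : J.NijenhuisZero

/-- `U` is the Hamiltonian vector field on `(M, σ)` corresponding to `f`, with the sign convention
`ι_U σ = df`. -/
def IsHamiltonianField (σ : DForm E M 2) (f : M → ℝ) (U : VField E M) : Prop :=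
  ∀ x v, σ x ![U x, v] = dirDeriv f x v

end Calculus

/-! ### `G₂` structures -/

/-- The Euclidean space of dimension `n`. -/
abbrev Euc (n : ℕ) : Type := EuclideanSpace ℝ (Fin n)

/-- The value on `v₁, …, vₖ` of the form `e^{s₁} ∧ … ∧ e^{sₖ}` on `ℝ⁷`, where `e⁰, …, e⁶` is the
standard dual basis. -/
def basicForm {k : ℕ} (s : Fin k → Fin 7) (v : Fin k → Euc 7) : ℝ :=
  Matrix.det (Matrix.of fun a b => v a (s b))

/-- The standard `G₂` 3-form on `ℝ⁷`. -/
def stdPhi (v : Fin 3 → Euc 7) : ℝ :=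
  basicForm ![0, 1, 2] v + basicForm ![0, 3, 4] v + basicForm ![0, 5, 6] v
    + basicForm ![1, 3, 5] v - basicForm ![1, 4, 6] v - basicForm ![2, 3, 6] v
    - basicForm ![2, 4, 5] v

/-- The Hodge dual of the standard `G₂` 3-form, for the standard metric and orientation of `ℝ⁷`. -/
def stdStarPhi (v : Fin 4 → Euc 7) : ℝ :=
  basicForm ![3, 4, 5, 6] v + basicForm ![1, 2, 5, 6] v + basicForm ![1, 2, 3, 4] v
    + basicForm ![0, 2, 4, 6] v - basicForm ![0, 2, 3, 5] v - basicForm ![0, 1, 4, 5] v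
    - basicForm ![0, 1, 3, 6] v

section G2

variable (Y : Type*) [TopologicalSpace Y] [ChartedSpace (Euc 7) Y] [IsManifold 𝓘(ℝ, Euc 7) ∞ Y]

/-- A `G₂` structure on the 7-manifold `Y`: an admissible 3-form `φ`, together with the Riemannian
metric and the 4-form `*φ` that it determines. Each tangent space has a linear
isomorphism onto `ℝ⁷` that carries `φ` to the standard 3-form; any such isomorphism carries the
metric and `*φ` to the standard ones, as the stabilizer `G₂` of the standard 3-form lies in
`SO(7)`. -/
structure G2Structure where
  phi : DForm (Euc 7) Y 3
  metric : RMetric (Euc 7) Y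
  starPhi : DForm (Euc 7) Y 4
  smooth_phi : phi.Smooth
  smooth_starPhi : starPhi.Smooth
  adapted : ∀ y : Y, ∃ e : TangentSpace 𝓘(ℝ, Euc 7) y ≃L[ℝ] Euc 7,
    (∀ v, phi y v = stdPhi (fun i => e (v i))) ∧
    (∀ v w, metric.ip y v w = inner ℝ (e v) (e w)) ∧
    (∀ v, starPhi y v = stdStarPhi (fun i => e (v i)))

variable {Y}

/-- A torsion-free `G₂` structure: `φ` and `*φ` are closed. -/
def G2Structure.TorsionFree (G : G2Structure Y) : Prop := G.phi.Closed ∧ G.starPhi.Closed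

/-- `X` is an infinitesimal automorphism of the `G₂` structure: `L_X φ = 0`. -/
def G2Structure.IsInfinitesimalAutomorphism (G : G2Structure Y) (X : VField (Euc 7) Y) : Prop :=
  G.phi.IsPreservedBy X

variable {N : Type*} [TopologicalSpace N] [ChartedSpace (Euc 6) N] [IsManifold 𝓘(ℝ, Euc 6) ∞ N]

/-- The differential of `p : Y → N` at `y`. -/
def projDeriv (p : Y → N) (y : Y) (v : TangentSpace 𝓘(ℝ, Euc 7) y) :
    TangentSpace 𝓘(ℝ, Euc 6) (p y) :=
  mfderiv 𝓘(ℝ, Euc 7) 𝓘(ℝ, Euc 6) p y v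

/-- `p : Y → N` is a quotient of `Y` by the nowhere zero vector field `V`: a smooth surjective
submersion whose fibres are tangent to `V`. -/
structure IsQuotientBy (p : Y → N) (V : VField (Euc 7) Y) : Prop where
  smooth : ContMDiff 𝓘(ℝ, Euc 7) 𝓘(ℝ, Euc 6) ∞ p
  surjective : Function.Surjective p
  submersion : ∀ y, Function.Surjective (projDeriv p y)
  ne_zero : ∀ y, V y ≠ 0
  kernel : ∀ y v, projDeriv p y v = 0 ↔ ∃ c : ℝ, v = c • V y

/-- The function `t = ‖V‖⁻¹` and the tensors `h`, `σ` on `N` are those induced by the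
`G₂` structure and `V`: the pullback of `σ` is `ι_V φ`, and `t h` is the quotient metric, that is,
`p` is a Riemannian submersion from the metric of `Y` to `t h`. -/
structure IsInducedOnQuotient (G : G2Structure Y) (V : VField (Euc 7) Y) (p : Y → N)
    (t : N → ℝ) (h : RMetric (Euc 6) N) (σ : DForm (Euc 6) N 2) : Prop where
  smooth_t : ContMDiff 𝓘(ℝ, Euc 6) 𝓘(ℝ, ℝ) ∞ t
  t_eq : ∀ y, t (p y) = (Real.sqrt (G.metric.ip y (V y) (V y)))⁻¹
  metric_eq : ∀ y v w, G.metric.ip y (V y) v = 0 → G.metric.ip y (V y) w = 0 →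
    G.metric.ip y v w = t (p y) * h.ip (p y) (projDeriv p y v) (projDeriv p y w)
  form_eq : ∀ y v w, σ (p y) ![projDeriv p y v, projDeriv p y w] = G.phi y ![V y, v, w]

/-- `W` is the horizontal lift of `U`: it projects to `U` and is orthogonal to `V`. -/
def IsHorizontalLift (k : RMetric (Euc 7) Y) (V : VField (Euc 7) Y) (p : Y → N)
    (U : VField (Euc 6) N) (W : VField (Euc 7) Y) : Prop :=
  ∀ y, projDeriv p y (W y) = U (p y) ∧ k.ip y (V y) (W y) = 0

end G2

end

/-!
The reason for the extra symmetry is that `ι_W φ` is exact, where `W` is the horizontal lift of the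
Hamiltonian field `U` of `-t`. Since `dφ = 0`, Cartan's formula then gives `L_W φ = 0`.

*The structure of the quotient.* Let `θ = t² k(V, ·)` be the connection form of the fibration by the
orbits of `V`. Then `φ = θ ∧ σ + t Re Ψ` and `ι_V *φ = ± Im Ψ`, where `Ψ` is a form of type `(3, 0)`
on the base; the lift of `J` to horizontal vectors is `t V ×`, by the identity of the cross product
(`stdPhi_stdCross`, `LocalModel.exists_lift_J`). As `L_V *φ = 0` and `d *φ = 0`, the form `Im Ψ` is
closed. If `J` is integrable, then `dΨ` has type `(3, 1)`, so that `Re Ψ` is closed as well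
(`extDeriv_eq_zero_of_integrable`).

*The curvature.* Now `0 = dφ = dθ ∧ σ + dt ∧ Re Ψ`, and `dt = -ι_U σ`. In real dimension 6 this
determines `dθ` by linear algebra: `dθ = -ι_U Re Ψ` (`eq_neg_of_wedge_eq`,
`LocalModel.curvature`). Forms on the base are handled as pullbacks under local sections of the
projection. Consequently `ι_W φ = t ι_U Re Ψ + θ ∧ dt = -d(t θ)` (`LocalModel.interior_phi_eq`).

*From the 3-form to the metric.* A vector field that preserves `φ` preserves the metric and `*φ`.
Instead of the subgroup `G₂ ⊂ SO(7)`, the proof uses a curve of `G₂` structures whose 3-form is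
stationary to first order: the derivative of `*φ(a, b, x, y) = φ(x, y, a × b) - (k(a, x) k(b, y) -
k(a, y) k(b, x))` and two contractions show that the metric and `*φ` are stationary
(`G2Triple_rigidity`). This is used both for `V`, where it gives `L_V *φ = 0`, and for `W`.

*The bracket.* `[W, V]` projects to zero, and it is orthogonal to `V` because `V` preserves the
metric and `k(V, W) = 0` (`LocalModel.lieBracket_lift`).

All this is local, so it is proved for a `LocalModel` on open subsets of normed spaces, where
Mathlib's exterior derivative lives. The hypotheses are carried to charts and the conclusions back by
testing on vector fields that are constant in a chart.
-/

noncomputable section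

set_option synthInstance.maxHeartbeats 400000

/-! ### Lie derivatives and Cartan's formula on a normed space -/

section FlatLie

variable {E : Type*} [NormedAddCommGroup E] [NormedSpace ℝ E] {n : ℕ}

/-- The Lie derivative along `X` of a differential form `α` on a normed space, written in
coordinates: `D_X α (v) + ∑ i, α (…, DX (v i), …)`. -/
def flatLie (X : E → E) (α : E → E [⋀^Fin n]→L[ℝ] ℝ) (z : E) (v : Fin n → E) : ℝ :=
  fderiv ℝ α z (X z) v + ∑ i, α z (Function.update v i (fderiv ℝ X z (v i)))

variable (E n) in
/-- `ContinuousAlternatingMap.curryLeft` as a continuous linear map. -/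
def curryLeftCLM : (E [⋀^Fin (n + 1)]→L[ℝ] ℝ) →L[ℝ] (E →L[ℝ] E [⋀^Fin n]→L[ℝ] ℝ) :=
  ContinuousAlternatingMap.curryLeftLI.toContinuousLinearMap

@[simp]
lemma curryLeftCLM_apply (β : E [⋀^Fin (n + 1)]→L[ℝ] ℝ) : curryLeftCLM E n β = β.curryLeft := rfl

/-- The interior product `ι_X α`. -/
def interiorProd (X : E → E) (α : E → E [⋀^Fin (n + 1)]→L[ℝ] ℝ) (z : E) : E [⋀^Fin n]→L[ℝ] ℝ :=
  (α z).curryLeft (X z)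

lemma interiorProd_apply (X : E → E) (α : E → E [⋀^Fin (n + 1)]→L[ℝ] ℝ) (z : E) (v : Fin n → E) :
    interiorProd X α z v = α z (Matrix.vecCons (X z) v) := rfl

lemma hasFDerivAt_interiorProd {X : E → E} {α : E → E [⋀^Fin (n + 1)]→L[ℝ] ℝ} {z : E}
    (hX : DifferentiableAt ℝ X z) (hα : DifferentiableAt ℝ α z) :
    HasFDerivAt (interiorProd X α)
      ((α z).curryLeft ∘L fderiv ℝ X z + (curryLeftCLM E n ∘L fderiv ℝ α z).flip (X z)) z := by
  have h1 : HasFDerivAt (fun z => curryLeftCLM E n (α z)) (curryLeftCLM E n ∘L fderiv ℝ α z) z :=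
    HasFDerivAt.comp z (g := curryLeftCLM E n) (ContinuousLinearMap.hasFDerivAt _) hα.hasFDerivAt
  exact h1.clm_apply hX.hasFDerivAt

lemma contDiffAt_interiorProd {X : E → E} {α : E → E [⋀^Fin (n + 1)]→L[ℝ] ℝ} {z : E}
    {m : WithTop ℕ∞} (hX : ContDiffAt ℝ m X z) (hα : ContDiffAt ℝ m α z) :
    ContDiffAt ℝ m (interiorProd X α) z :=
  ContDiffAt.clm_apply (f := fun z => curryLeftCLM E n (α z))
    (ContDiffAt.comp z (g := curryLeftCLM E n) (ContinuousLinearMap.contDiff _).contDiffAt hα) hX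

/-- Cartan's formula `d ι_X α + ι_X dα = L_X α`. -/
lemma extDeriv_interiorProd_add {X : E → E} {α : E → E [⋀^Fin (n + 1)]→L[ℝ] ℝ} {z : E}
    (hX : DifferentiableAt ℝ X z) (hα : DifferentiableAt ℝ α z) (v : Fin (n + 1) → E) :
    extDeriv (interiorProd X α) z v + extDeriv α z (Matrix.vecCons (X z) v)
      = flatLie X α z v := by
  rw [extDeriv, (hasFDerivAt_interiorProd hX hα).fderiv, extDeriv,
    ContinuousAlternatingMap.alternatizeUncurryFin_apply,
    ContinuousAlternatingMap.alternatizeUncurryFin_apply, Fin.sum_univ_succ (n := n + 1), flatLie,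
    add_left_comm]
  congr 1
  · simp [Matrix.vecCons]
  · rw [← Finset.sum_add_distrib]
    refine Finset.sum_congr rfl fun i _ => ?_
    have h2 : (i.succ.removeNth (Matrix.vecCons (X z) v) : Fin (n + 1) → E)
        = Matrix.vecCons (X z) (i.removeNth v) := by
      ext j
      refine Fin.cases ?_ (fun j => ?_) j <;> simp [Fin.removeNth]
    have h3 : α z (Function.update v i (fderiv ℝ X z (v i)))
        = (-1) ^ (i : ℕ) • α z (Matrix.vecCons (fderiv ℝ X z (v i)) (i.removeNth v)) := by
      rw [← Fin.insertNth_removeNth]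
      exact AlternatingMap.map_insertNth (α z).toAlternatingMap i _ _
    rw [h2, h3]
    simp [pow_succ, ContinuousLinearMap.flip_apply]

lemma hasDerivAt_comp_line {B : Type*} [NormedAddCommGroup B] [NormedSpace ℝ B] {k : E → B} {z : E}
    (hk : DifferentiableAt ℝ k z) (v : E) :
    HasDerivAt (fun s : ℝ => k (z + s • v)) (fderiv ℝ k z v) 0 := by
  have hl : HasDerivAt (fun s : ℝ => z + s • v) v 0 := by
    simpa using ((hasDerivAt_id (0 : ℝ)).smul_const v).const_add z
  have h : HasFDerivAt k (fderiv ℝ k z) (z + (0 : ℝ) • v) := by simpa using hk.hasFDerivAt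
  exact h.comp_hasDerivAt (0 : ℝ) hl

/-- Moving a form along the straight line with direction `X z`, and the vectors along `1 + s DX`,
its derivative at `s = 0` is the Lie derivative. -/
lemma hasDerivAt_flatLie {X : E → E} {α : E → E [⋀^Fin n]→L[ℝ] ℝ} {z : E}
    (hα : DifferentiableAt ℝ α z) :
    ∃ D : E [⋀^Fin n]→L[ℝ] ℝ, (∀ v, D v = flatLie X α z v) ∧
      HasDerivAt (fun s : ℝ => (α (z + s • X z)).compContinuousLinearMap
        (ContinuousLinearMap.id ℝ E + s • fderiv ℝ X z)) D 0 := by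
  have hg : HasDerivAt (fun s : ℝ => ContinuousLinearMap.id ℝ E + s • fderiv ℝ X z)
      (fderiv ℝ X z) 0 := by
    simpa using ((hasDerivAt_id (0 : ℝ)).smul_const (fderiv ℝ X z)).const_add
      (ContinuousLinearMap.id ℝ E)
  have h2 := (hasDerivAt_comp_line hα (X z)).hasFDerivAt.continuousAlternatingMapCompContinuousLinearMap
    hg.hasFDerivAt
  refine ⟨_, fun v => ?_, h2.hasDerivAt⟩
  simp [flatLie, ContinuousAlternatingMap.fderivCompContinuousLinearMap_apply]
  refine Finset.sum_congr rfl fun i _ => congrArg _ ?_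
  ext j
  rcases eq_or_ne j i with rfl | h <;> simp [*]

lemma exists_hasDerivAt_bilinearComp {κ : ℝ → E →L[ℝ] E →L[ℝ] ℝ} {κ' : E →L[ℝ] E →L[ℝ] ℝ}
    {g : ℝ → E →L[ℝ] E} {g' : E →L[ℝ] E} {s : ℝ} (hκ : HasDerivAt κ κ' s)
    (hg : HasDerivAt g g' s) :
    ∃ D, HasDerivAt (fun s => (κ s).bilinearComp (g s) (g s)) D s := by
  have h1 : HasDerivAt (fun s : ℝ => (ContinuousLinearMap.compL ℝ E E ℝ).flip (g s))
      ((ContinuousLinearMap.compL ℝ E E ℝ).flip g') s :=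
    HasFDerivAt.comp_hasDerivAt (l := (ContinuousLinearMap.compL ℝ E E ℝ).flip) s
      (ContinuousLinearMap.hasFDerivAt _) hg
  exact ⟨_, h1.clm_comp (hκ.clm_comp hg)⟩

/-- The analogue of `hasDerivAt_flatLie` for a field of bilinear forms. -/
lemma hasDerivAt_bilinearComp {X : E → E} {k : E → E →L[ℝ] E →L[ℝ] ℝ} {z : E}
    (hk : DifferentiableAt ℝ k z) :
    ∃ D : E →L[ℝ] E →L[ℝ] ℝ, (∀ a b, D a b = fderiv ℝ k z (X z) a b
        + k z (fderiv ℝ X z a) b + k z a (fderiv ℝ X z b)) ∧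
      HasDerivAt (fun s : ℝ => (k (z + s • X z)).bilinearComp
        (ContinuousLinearMap.id ℝ E + s • fderiv ℝ X z)
        (ContinuousLinearMap.id ℝ E + s • fderiv ℝ X z)) D 0 := by
  have hg : HasDerivAt (fun s : ℝ => ContinuousLinearMap.id ℝ E + s • fderiv ℝ X z)
      (fderiv ℝ X z) 0 := by
    simpa using ((hasDerivAt_id (0 : ℝ)).smul_const (fderiv ℝ X z)).const_add
      (ContinuousLinearMap.id ℝ E)
  have hkl := hasDerivAt_comp_line (B := E →L[ℝ] E →L[ℝ] ℝ) hk (X z)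
  obtain ⟨D, hkd⟩ := exists_hasDerivAt_bilinearComp hkl hg
  refine ⟨D, fun a b => ?_, hkd⟩
  have h3 := (hkd.clm_apply (hasDerivAt_const (0 : ℝ) a)).clm_apply
    (hasDerivAt_const (0 : ℝ) b)
  have h4 := (hkl.clm_apply (hg.clm_apply (hasDerivAt_const (0 : ℝ) a))).clm_apply
    (hg.clm_apply (hasDerivAt_const (0 : ℝ) b))
  have h5 := h3.unique h4
  simp at h5
  rw [h5]

lemma eventually_id_add_smul_mem_range [CompleteSpace E] (L : E →L[ℝ] E) :
    ∀ᶠ s : ℝ in nhds 0, ∃ g : E ≃L[ℝ] E, (g : E →L[ℝ] E) = ContinuousLinearMap.id ℝ E + s • L := by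
  have hc : Continuous fun s : ℝ => ContinuousLinearMap.id ℝ E + s • L := by fun_prop
  refine hc.continuousAt.eventually (p := fun A => ∃ g : E ≃L[ℝ] E, (g : E →L[ℝ] E) = A) ?_
  simp only [zero_smul, add_zero]
  exact ContinuousLinearEquiv.nhds (ContinuousLinearEquiv.refl ℝ E)

end FlatLie

/-! ### The cross product of the standard `G₂` structure -/

section StandardModel

lemma basicForm_three (s : Fin 3 → Fin 7) (a b c : Euc 7) :
    basicForm s ![a, b, c] = a (s 0) * b (s 1) * c (s 2) - a (s 0) * b (s 2) * c (s 1)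
      - a (s 1) * b (s 0) * c (s 2) + a (s 1) * b (s 2) * c (s 0)
      + a (s 2) * b (s 0) * c (s 1) - a (s 2) * b (s 1) * c (s 0) := by
  simp [basicForm, Matrix.det_fin_three]

lemma basicForm_four (s : Fin 4 → Fin 7) (a b c d : Euc 7) :
    basicForm s ![a, b, c, d] =
      a (s 0) * basicForm ![s 1, s 2, s 3] ![b, c, d]
      - a (s 1) * basicForm ![s 0, s 2, s 3] ![b, c, d]
      + a (s 2) * basicForm ![s 0, s 1, s 3] ![b, c, d]
      - a (s 3) * basicForm ![s 0, s 1, s 2] ![b, c, d] := by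
  simp only [basicForm_three]
  rw [basicForm, Matrix.det_succ_row_zero]
  simp [Fin.sum_univ_succ, Matrix.det_fin_three, Fin.succAbove]
  ring

/-- The cross product of the standard `G₂` structure. -/
def stdCross (a b : Euc 7) : Euc 7 :=
  !₂[a 1 * b 2 - a 2 * b 1 + (a 3 * b 4 - a 4 * b 3) + (a 5 * b 6 - a 6 * b 5),
    a 2 * b 0 - a 0 * b 2 + (a 3 * b 5 - a 5 * b 3) - (a 4 * b 6 - a 6 * b 4),
    a 0 * b 1 - a 1 * b 0 - (a 3 * b 6 - a 6 * b 3) - (a 4 * b 5 - a 5 * b 4),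
    a 4 * b 0 - a 0 * b 4 + (a 5 * b 1 - a 1 * b 5) - (a 6 * b 2 - a 2 * b 6),
    a 0 * b 3 - a 3 * b 0 - (a 6 * b 1 - a 1 * b 6) - (a 5 * b 2 - a 2 * b 5),
    a 6 * b 0 - a 0 * b 6 + (a 1 * b 3 - a 3 * b 1) - (a 2 * b 4 - a 4 * b 2),
    a 0 * b 5 - a 5 * b 0 - (a 1 * b 4 - a 4 * b 1) - (a 2 * b 3 - a 3 * b 2)]

lemma inner_euc (a b : Euc 7) : inner ℝ a b = ∑ i, a i * b i := by
  simp [PiLp.inner_apply, mul_comm]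

lemma inner_stdCross (a b c : Euc 7) : inner ℝ (stdCross a b) c = stdPhi ![a, b, c] := by
  simp [inner_euc, Fin.sum_univ_seven, stdCross, stdPhi, basicForm_three]
  ring

set_option maxRecDepth 4000 in
/-- The identity for the cross product of a cross product, paired with a vector. -/
lemma stdPhi_stdCross (a b c d : Euc 7) :
    stdPhi ![c, d, stdCross a b] = inner ℝ a c * inner ℝ b d - inner ℝ a d * inner ℝ b c
      + stdStarPhi ![a, b, c, d] := by
  simp [inner_euc, Fin.sum_univ_seven, stdCross, stdPhi, stdStarPhi, basicForm_four, basicForm_three]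
  ring

lemma eq_sum_single (x : Euc 7) : x = ∑ i, x i • EuclideanSpace.single i (1 : ℝ) := by
  ext j
  simp [Pi.single_apply]

lemma bilin_euc (κ : Euc 7 →L[ℝ] Euc 7 →L[ℝ] ℝ) (a b : Euc 7) :
    κ a b = ∑ i, ∑ j, a i * b j * κ (EuclideanSpace.single i 1) (EuclideanSpace.single j 1) := by
  conv_lhs => rw [eq_sum_single a, eq_sum_single b]
  simp only [map_sum, map_smul, _root_.sum_apply, _root_.smul_apply, smul_eq_mul, Finset.mul_sum,
    mul_assoc]
  rw [Finset.sum_comm]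
  exact Finset.sum_congr rfl fun i _ => Finset.sum_congr rfl fun j _ => by ring

set_option maxRecDepth 4000 in
/-- On the orthogonal complement of `u`, the map `u ×` is `|u|` times an isometry. -/
lemma sum_bilin_stdCross (κ : Euc 7 →L[ℝ] Euc 7 →L[ℝ] ℝ) (hκ : ∀ a b, κ a b = κ b a) (u : Euc 7) :
    ∑ i, κ (stdCross u (EuclideanSpace.single i 1)) (stdCross u (EuclideanSpace.single i 1))
      = inner ℝ u u * ∑ i, κ (EuclideanSpace.single i 1) (EuclideanSpace.single i 1) - κ u u := by
  simp only [bilin_euc κ (stdCross _ _), bilin_euc κ u u]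
  obtain ⟨K, hK⟩ : ∃ K : Fin 7 → Fin 7 → ℝ, ∀ i j,
    κ (EuclideanSpace.single i 1) (EuclideanSpace.single j 1) = K i j := ⟨_, fun _ _ => rfl⟩
  have hs : ∀ i j, K i j = K j i := fun i j => by rw [← hK, ← hK, hκ]
  simp only [hK, inner_euc, Fin.sum_univ_seven, stdCross]
  simp
  rw [hs 1 0, hs 2 0, hs 3 0, hs 4 0, hs 5 0, hs 6 0, hs 2 1, hs 3 1, hs 4 1, hs 5 1, hs 6 1,
    hs 3 2, hs 4 2, hs 5 2, hs 6 2, hs 4 3, hs 5 3, hs 6 3, hs 5 4, hs 6 4, hs 6 5]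
  ring

/-- The identity `κ(u × x, u × x) + κ(u, u)|x|² + |u|²κ(x, x) = 2⟨u, x⟩κ(u, x)` expresses that an
infinitesimal change `κ` of the metric does not affect `φ`; contraction over `x` shows that `κ` is a
multiple of the metric, and a second contraction that it vanishes. -/
lemma bilin_eq_zero_of_stdCross (κ : Euc 7 →L[ℝ] Euc 7 →L[ℝ] ℝ) (hκ : ∀ a b, κ a b = κ b a)
    (h : ∀ u x, -κ (stdCross u x) (stdCross u x)
      = κ u u * inner ℝ x x + inner ℝ u u * κ x x - 2 * (inner ℝ u x * κ u x)) :
    ∀ a b, κ a b = 0 := by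
  set T := ∑ i, κ (EuclideanSpace.single i 1) (EuclideanSpace.single i 1) with hT
  -- summing over an orthonormal basis of `x`, the constant `4` is `7 - 1 - 2`
  have h1 : ∀ u : Euc 7, 4 * κ u u = -2 * (inner ℝ u u * T) := by
    intro u
    have h2 := Finset.sum_congr rfl fun i (_ : i ∈ Finset.univ) =>
      h u (EuclideanSpace.single (i : Fin 7) 1)
    have h3 : ∑ i, inner ℝ u (EuclideanSpace.single i 1) * κ u (EuclideanSpace.single i 1)
        = κ u u := by
      have h4 := congrArg (κ u) (eq_sum_single u)
      rw [map_sum] at h4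
      rw [h4]
      simp [EuclideanSpace.inner_single_right]
    simp only [Finset.sum_neg_distrib, sum_bilin_stdCross κ hκ, Finset.sum_add_distrib,
      Finset.sum_sub_distrib, ← Finset.mul_sum, h3, ← hT] at h2
    simp at h2
    simp at *
    linarith
  have h0 : T = 0 := by
    have h2 := Finset.sum_congr rfl fun i (_ : i ∈ Finset.univ) =>
      h1 (EuclideanSpace.single (i : Fin 7) 1)
    rw [← Finset.mul_sum, ← hT] at h2
    simp at h2
    linarith
  have h4 : ∀ u, κ u u = 0 := fun u => by
    have := h1 u
    rw [h0] at this
    linarith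
  intro a b
  have h5 := h4 (a + b)
  simp only [map_add, _root_.add_apply, h4, hκ b a] at h5
  linarith

end StandardModel

/-! ### The 3-form determines the metric and the dual 4-form to first order -/

section G2Triple
open Filter Topology

variable {E : Type*} [NormedAddCommGroup E] [NormedSpace ℝ E]

/-- `φ`, `k` and `χ` are the 3-form, the metric and the dual 4-form of one `G₂` structure on
a 7-dimensional space: one linear isomorphism onto `ℝ⁷` carries the three of them to the standard
ones. -/
def IsG2Triple (φ : E [⋀^Fin 3]→L[ℝ] ℝ) (k : E →L[ℝ] E →L[ℝ] ℝ)
    (χ : E [⋀^Fin 4]→L[ℝ] ℝ) : Prop :=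
  ∃ e : E ≃L[ℝ] Euc 7, (∀ v, φ v = stdPhi fun i => e (v i)) ∧
    (∀ v w, k v w = inner ℝ (e v) (e w)) ∧ ∀ v, χ v = stdStarPhi fun i => e (v i)

lemma comp_vec3 {α β : Type*} (f : α → β) (a b c : α) :
    (fun i => f ((![a, b, c] : Fin 3 → α) i)) = ![f a, f b, f c] := by
  ext i; fin_cases i <;> rfl

lemma comp_vec4 {α β : Type*} (f : α → β) (a b c d : α) :
    (fun i => f ((![a, b, c, d] : Fin 4 → α) i)) = ![f a, f b, f c, f d] := by
  ext i; fin_cases i <;> rfl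

namespace IsG2Triple

variable {φ : E [⋀^Fin 3]→L[ℝ] ℝ} {k : E →L[ℝ] E →L[ℝ] ℝ}
  {χ : E [⋀^Fin 4]→L[ℝ] ℝ}

lemma symm (h : IsG2Triple φ k χ) (a b : E) : k a b = k b a := by
  obtain ⟨e, -, hk, -⟩ := h
  rw [hk, hk, real_inner_comm]

lemma pos (h : IsG2Triple φ k χ) {a : E} (ha : a ≠ 0) : 0 < k a a := by
  obtain ⟨e, -, hk, -⟩ := h
  rw [hk]
  exact real_inner_self_pos.2 (by simpa using ha)

lemma eq_of_metric (h : IsG2Triple φ k χ) {a b : E} (hab : ∀ w, k a w = k b w) : a = b := by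
  by_contra hne
  refine (h.pos (sub_ne_zero.2 hne)).ne' ?_
  calc k (a - b) (a - b) = k a (a - b) - k b (a - b) := by rw [map_sub k a b]; rfl
    _ = 0 := by rw [hab, sub_self]

/-- The cross product of a `G₂` structure, and the expression of the dual 4-form through it. -/
lemma exists_cross (h : IsG2Triple φ k χ) : ∃ c : E → E → E,
    (∀ a b w, k (c a b) w = φ ![a, b, w]) ∧
    ∀ a b x y, φ ![x, y, c a b] = k a x * k b y - k a y * k b x + χ ![a, b, x, y] := by
  obtain ⟨e, hφ, hk, hχ⟩ := h
  refine ⟨fun a b => e.symm (stdCross (e a) (e b)), fun a b w => ?_, fun a b x y => ?_⟩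
  · rw [hk, hφ, comp_vec3 e, e.apply_symm_apply, inner_stdCross]
  · simp only [hk, hφ, hχ, comp_vec3 e, comp_vec4 e, e.apply_symm_apply, stdPhi_stdCross]

lemma isInvertible (h : IsG2Triple φ k χ) : k.IsInvertible := by
  have hinj : Function.Injective (k : E →ₗ[ℝ] E →L[ℝ] ℝ) := fun a b hab =>
    h.eq_of_metric fun w => DFunLike.congr_fun hab w
  obtain ⟨e, -⟩ := id h
  have : FiniteDimensional ℝ E := e.symm.toLinearEquiv.finiteDimensional
  have hfin : Module.finrank ℝ E = Module.finrank ℝ (E →L[ℝ] ℝ) := by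
    rw [← (LinearMap.toContinuousLinearMap (𝕜 := ℝ) (E := E) (F' := ℝ)).finrank_eq]
    exact Subspace.dual_finrank_eq.symm
  refine ⟨(LinearEquiv.ofInjectiveOfFinrankEq _ hinj hfin).toContinuousLinearEquiv, ?_⟩
  ext a b
  rfl

end IsG2Triple

section
variable {F : Type*} [NormedAddCommGroup F] [NormedSpace ℝ F]

/-- The 1-form `φ(a, b, ·)`, as a continuous linear function of `φ`. -/
def contractTwo (a b : E) : (E [⋀^Fin 3]→L[ℝ] ℝ) →L[ℝ] (E →L[ℝ] ℝ) :=
  (ContinuousAlternatingMap.ofSubsingletonLIE (𝕜 := ℝ) (E := E) (F := ℝ)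
      (0 : Fin 1)).symm.toContinuousLinearEquiv.toContinuousLinearMap ∘L
    (ContinuousLinearMap.apply ℝ _ b) ∘L curryLeftCLM E 1 ∘L
    (ContinuousLinearMap.apply ℝ _ a) ∘L curryLeftCLM E 2

lemma contractTwo_apply (a b c : E) (φ : E [⋀^Fin 3]→L[ℝ] ℝ) :
    contractTwo a b φ c = φ ![a, b, c] := by
  change φ (Matrix.vecCons a (Matrix.vecCons b fun _ => c)) = _
  congr 1
  ext i; fin_cases i <;> rfl

lemma DifferentiableAt.clm_inverse {G : Type*} [NormedAddCommGroup G] [NormedSpace ℝ G]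
    [CompleteSpace E] {k : G → E →L[ℝ] F} {s : G}
    (hk : DifferentiableAt ℝ k s) (hs : (k s).IsInvertible) :
    DifferentiableAt ℝ (fun s => (k s).inverse) s := by
  obtain ⟨e, he⟩ := hs
  have := (contDiffAt_map_inverse (𝕜 := ℝ) (n := 1) e).differentiableAt one_ne_zero
  rw [he] at this
  exact this.comp s hk

end

lemma HasDerivAt.alternatingMap_apply {n : ℕ} {φ : ℝ → E [⋀^Fin n]→L[ℝ] ℝ}
    {φ' : E [⋀^Fin n]→L[ℝ] ℝ} {s : ℝ} (hφ : HasDerivAt φ φ' s) (v : Fin n → E) :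
    HasDerivAt (fun s => φ s v) (φ' v) s :=
  ((ContinuousAlternatingMap.apply ℝ E ℝ v).hasFDerivAt (x := φ s)).comp_hasDerivAt s hφ

/-- If the 3-form of a curve of `G₂` structures is stationary to first order, then so are the metric
and the dual 4-form. -/
lemma G2Triple_rigidity {φ : ℝ → E [⋀^Fin 3]→L[ℝ] ℝ} {k : ℝ → E →L[ℝ] E →L[ℝ] ℝ}
    {χ : ℝ → E [⋀^Fin 4]→L[ℝ] ℝ} {κ : E →L[ℝ] E →L[ℝ] ℝ}
    {χ' : E [⋀^Fin 4]→L[ℝ] ℝ} (h : ∀ᶠ s in 𝓝 0, IsG2Triple (φ s) (k s) (χ s))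
    (hφ : HasDerivAt φ 0 0) (hk : HasDerivAt k κ 0) (hχ : HasDerivAt χ χ' 0) :
    κ = 0 ∧ χ' = 0 := by
  have h0 : IsG2Triple (φ 0) (k 0) (χ 0) := h.self_of_nhds
  have : FiniteDimensional ℝ E := by
    obtain ⟨e, -⟩ := h0
    exact e.symm.toLinearEquiv.finiteDimensional
  have : CompleteSpace E := FiniteDimensional.complete ℝ E
  have hcross : ∀ s, ∃ c : E → E → E, IsG2Triple (φ s) (k s) (χ s) →
      (∀ a b w, k s (c a b) w = φ s ![a, b, w]) ∧
      ∀ a b x y, φ s ![x, y, c a b] = k s a x * k s b y - k s a y * k s b x + χ s ![a, b, x, y] := by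
    intro s
    by_cases hs : IsG2Triple (φ s) (k s) (χ s)
    · obtain ⟨c, hc⟩ := hs.exists_cross
      exact ⟨c, fun _ => hc⟩
    · exact ⟨fun _ _ => 0, fun h => absurd h hs⟩
  choose c hc using hcross
  -- the cross product is differentiable, as it is obtained by inverting the metric
  have hcd : ∀ a b, DifferentiableAt ℝ (fun s => c s a b) 0 := by
    intro a b
    have h1 : DifferentiableAt ℝ (fun s => contractTwo a b (φ s)) 0 :=
      (((contractTwo a b).hasFDerivAt (x := φ 0)).comp_hasDerivAt (0 : ℝ) hφ).differentiableAt
    have h2 := DifferentiableAt.clm_inverse hk.differentiableAt h0.isInvertible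
    refine (h2.clm_apply h1).congr_of_eventuallyEq ?_
    filter_upwards [h] with s hs
    obtain ⟨e, he⟩ := hs.isInvertible
    rw [← he, ContinuousLinearMap.inverse_equiv]
    symm
    refine e.symm_apply_eq.2 ?_
    ext w
    rw [contractTwo_apply, ← (hc s hs).1, ← he]
    rfl
  have hc1 : ∀ a b, ∃ c' : E, HasDerivAt (fun s => c s a b) c' 0 := fun a b =>
    ⟨_, (hcd a b).hasDerivAt⟩
  choose c' hc' using hc1
  have hkap : ∀ a b, HasDerivAt (fun s => k s a b) (κ a b) 0 := fun a b => by
    simpa using (hk.clm_apply (hasDerivAt_const (0 : ℝ) a)).clm_apply (hasDerivAt_const (0 : ℝ) b)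
  -- differentiate `k(c, w) = φ(a, b, w)`
  have h1 : ∀ a b w, κ (c 0 a b) w + k 0 (c' a b) w = 0 := by
    intro a b w
    have h2 := (hk.clm_apply (hc' a b)).clm_apply (hasDerivAt_const (0 : ℝ) w)
    have h3 := (hφ.alternatingMap_apply ![a, b, w]).congr_of_eventuallyEq
      (f₁ := fun s => k s (c s a b) w) (by
        filter_upwards [h] with s hs using (hc s hs).1 a b w)
    simpa using h2.unique h3
  -- differentiate the expression of `χ` in terms of `φ` and `k`
  have h2 : ∀ a b x y, -κ (c 0 a b) (c 0 x y) = κ a x * k 0 b y + k 0 a x * κ b y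
      - (κ a y * k 0 b x + k 0 a y * κ b x) + χ' ![a, b, x, y] := by
    intro a b x y
    have h3 := ((((hkap a x).mul (hkap b y)).sub ((hkap a y).mul (hkap b x))).add
      (hχ.alternatingMap_apply ![a, b, x, y]))
    have h4 : HasDerivAt (fun s => contractTwo x y (φ s) (c s a b))
        (contractTwo x y (φ 0) (c' a b)) 0 := by
      have := (((contractTwo x y).hasFDerivAt (x := φ 0)).comp_hasDerivAt (0 : ℝ) hφ).clm_apply
        (hc' a b)
      simpa using this
    have h5 := h3.unique (h4.congr_of_eventuallyEq (by
      filter_upwards [h] with s hs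
      simp only [contractTwo_apply]
      exact ((hc s hs).2 a b x y).symm))
    rw [contractTwo_apply, ← (hc 0 h0).1, h0.symm (c 0 x y)] at h5
    have h6 := h1 a b (c 0 x y)
    linarith
  have hsymm : ∀ a b, κ a b = κ b a := fun a b =>
    (hkap a b).unique ((hkap b a).congr_of_eventuallyEq (by
      filter_upwards [h] with s hs using hs.symm a b))
  obtain ⟨e, hφe, hke, hχe⟩ := id h0
  have hce : ∀ a b, c 0 a b = e.symm (stdCross (e a) (e b)) := fun a b =>
    h0.eq_of_metric fun w => by
      rw [(hc 0 h0).1, hke, hφe, comp_vec3 e, e.apply_symm_apply, inner_stdCross]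
  have hκ0 : κ = 0 := by
    have h3 := bilin_eq_zero_of_stdCross
      (κ.bilinearComp (e.symm : Euc 7 →L[ℝ] E) (e.symm : Euc 7 →L[ℝ] E))
      (fun a b => by simp [hsymm]) (fun u x => by
        have h4 := h2 (e.symm u) (e.symm x) (e.symm u) (e.symm x)
        have h5 : χ' ![e.symm u, e.symm x, e.symm u, e.symm x] = 0 :=
          χ'.map_eq_zero_of_eq _ (i := 0) (j := 2) (by simp) (by decide)
        rw [h5, hce] at h4
        simp only [hke, e.apply_symm_apply] at h4
        simp
        rw [h4, real_inner_comm x u, hsymm (e.symm x) (e.symm u), real_inner_self_eq_norm_sq,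
          real_inner_self_eq_norm_sq]
        ring)
    ext a b
    simpa using h3 (e a) (e b)
  refine ⟨hκ0, ?_⟩
  ext v
  have h3 := h2 (v 0) (v 1) (v 2) (v 3)
  have h4 : ![v 0, v 1, v 2, v 3] = v := by ext i; fin_cases i <;> rfl
  rw [hκ0, h4] at h3
  simpa using h3.symm

end G2Triple

/-! ### Forms and complex structures in real dimension 6 -/

section ComplexType
open Filter Topology

variable {E : Type*} [NormedAddCommGroup E] [NormedSpace ℝ E]

/-- An orthonormal basis for an inner product given as a bilinear form, on a space whose norm is
unrelated to it. -/
lemma exists_orthonormal_frame {E : Type*} [AddCommGroup E] [Module ℝ E] [FiniteDimensional ℝ E]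
    (B : E →ₗ[ℝ] E →ₗ[ℝ] ℝ) (hB : ∀ a b, B a b = B b a) (hpos : ∀ a, a ≠ 0 → 0 < B a a) :
    ∃ b : Fin (Module.finrank ℝ E) → E, (∀ i, B (b i) (b i) = 1) ∧
      ∀ x, x = ∑ i, B (b i) x • b i := by
  let core : InnerProductSpace.Core ℝ E :=
    { inner := fun v w => B v w
      conj_inner_symm := fun v w => hB w v
      re_inner_nonneg := fun v => by
        rcases eq_or_ne v 0 with rfl | hv
        · simp
        · simpa using (hpos v hv).le
      add_left := fun v w x => by simp
      smul_left := fun c v => by simp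
      definite := fun v h => by
        contrapose! h
        exact (hpos v h).ne' }
  let _ : NormedAddCommGroup E := core.toNormedAddCommGroup
  let _ : InnerProductSpace ℝ E := InnerProductSpace.ofCore core.toCore
  refine ⟨stdOrthonormalBasis ℝ E, fun i => ?_, fun x => ?_⟩
  · exact inner_self_eq_one_of_norm_eq_one ((stdOrthonormalBasis ℝ E).norm_eq_one i)
  · exact ((stdOrthonormalBasis ℝ E).sum_repr' x).symm

lemma alt2_swap (f : E [⋀^Fin 2]→L[ℝ] ℝ) (a b : E) : f ![a, b] = -f ![b, a] := by
  refine (congrArg f ?_).trans (f.map_swap ![b, a] (show (0 : Fin 2) ≠ 1 by decide))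
  ext i; fin_cases i <;> rfl

lemma alt3_swap01 (f : E [⋀^Fin 3]→L[ℝ] ℝ) (a b c : E) : f ![a, b, c] = -f ![b, a, c] := by
  refine (congrArg f ?_).trans (f.map_swap ![b, a, c] (show (0 : Fin 3) ≠ 1 by decide))
  ext i; fin_cases i <;> rfl

lemma alt3_swap12 (f : E [⋀^Fin 3]→L[ℝ] ℝ) (a b c : E) : f ![a, b, c] = -f ![a, c, b] := by
  refine (congrArg f ?_).trans (f.map_swap ![a, c, b] (show (1 : Fin 3) ≠ 2 by decide))
  ext i; fin_cases i <;> rfl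

lemma alt4_swap01 (f : E [⋀^Fin 4]→L[ℝ] ℝ) (a b c d : E) :
    f ![a, b, c, d] = -f ![b, a, c, d] := by
  refine (congrArg f ?_).trans (f.map_swap ![b, a, c, d] (show (0 : Fin 4) ≠ 1 by decide))
  ext i; fin_cases i <;> rfl

lemma alt4_swap12 (f : E [⋀^Fin 4]→L[ℝ] ℝ) (a b c d : E) :
    f ![a, b, c, d] = -f ![a, c, b, d] := by
  refine (congrArg f ?_).trans (f.map_swap ![a, c, b, d] (show (1 : Fin 4) ≠ 2 by decide))
  ext i; fin_cases i <;> rfl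

lemma alt_cons_add {n : ℕ} (f : E [⋀^Fin (n + 1)]→L[ℝ] ℝ) (a b : E) (v : Fin n → E) :
    f (Matrix.vecCons (a + b) v) = f (Matrix.vecCons a v) + f (Matrix.vecCons b v) := by
  exact DFunLike.congr_fun (map_add f.curryLeft a b) v

lemma alt_cons_smul {n : ℕ} (f : E [⋀^Fin (n + 1)]→L[ℝ] ℝ) (c : ℝ) (a : E) (v : Fin n → E) :
    f (Matrix.vecCons (c • a) v) = c * f (Matrix.vecCons a v) := by
  exact DFunLike.congr_fun (map_smul f.curryLeft c a) v

lemma alt_cons_neg {n : ℕ} (f : E [⋀^Fin (n + 1)]→L[ℝ] ℝ) (a : E) (v : Fin n → E) :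
    f (Matrix.vecCons (-a) v) = -f (Matrix.vecCons a v) := by
  exact DFunLike.congr_fun (map_neg f.curryLeft a) v

lemma alt_cons_sum {n : ℕ} {ι : Type*} (s : Finset ι) (f : E [⋀^Fin (n + 1)]→L[ℝ] ℝ) (a : ι → E)
    (v : Fin n → E) :
    f (Matrix.vecCons (∑ i ∈ s, a i) v) = ∑ i ∈ s, f (Matrix.vecCons (a i) v) := by
  have h := DFunLike.congr_fun (map_sum f.curryLeft a s) v
  rw [ContinuousAlternatingMap.sum_apply] at h
  exact h

lemma extDeriv_one_apply (α : E → E [⋀^Fin 1]→L[ℝ] ℝ) (x a b : E) :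
    extDeriv α x ![a, b] = fderiv ℝ α x a ![b] - fderiv ℝ α x b ![a] := by
  rw [extDeriv, ContinuousAlternatingMap.alternatizeUncurryFin_apply]
  have h0 : (Fin.removeNth (0 : Fin 2) (![a, b] : Fin 2 → E) : Fin 1 → E) = ![b] := by
    ext i; fin_cases i; rfl
  have h1 : (Fin.removeNth (1 : Fin 2) (![a, b] : Fin 2 → E) : Fin 1 → E) = ![a] := by
    ext i; fin_cases i; rfl
  rw [Fin.sum_univ_two, h0, h1]
  simp [sub_eq_add_neg]

lemma extDeriv_two_apply (α : E → E [⋀^Fin 2]→L[ℝ] ℝ) (x a b c : E) :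
    extDeriv α x ![a, b, c] = fderiv ℝ α x a ![b, c] - fderiv ℝ α x b ![a, c]
      + fderiv ℝ α x c ![a, b] := by
  have h0 : (Fin.removeNth (0 : Fin 3) (![a, b, c] : Fin 3 → E) : Fin 2 → E) = ![b, c] := by
    ext i; fin_cases i <;> rfl
  have h1 : (Fin.removeNth (1 : Fin 3) (![a, b, c] : Fin 3 → E) : Fin 2 → E) = ![a, c] := by
    ext i; fin_cases i <;> rfl
  have h2 : (Fin.removeNth (2 : Fin 3) (![a, b, c] : Fin 3 → E) : Fin 2 → E) = ![a, b] := by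
    ext i; fin_cases i <;> rfl
  rw [extDeriv, ContinuousAlternatingMap.alternatizeUncurryFin_apply, Fin.sum_univ_three, h0, h1,
    h2]
  simp
  ring

lemma extDeriv_three_apply (α : E → E [⋀^Fin 3]→L[ℝ] ℝ) (x a b c d : E) :
    extDeriv α x ![a, b, c, d] = fderiv ℝ α x a ![b, c, d] - fderiv ℝ α x b ![a, c, d]
      + fderiv ℝ α x c ![a, b, d] - fderiv ℝ α x d ![a, b, c] := by
  have h0 : (Fin.removeNth (0 : Fin 4) (![a, b, c, d] : Fin 4 → E) : Fin 3 → E) = ![b, c, d] := by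
    ext i; fin_cases i <;> rfl
  have h1 : (Fin.removeNth (1 : Fin 4) (![a, b, c, d] : Fin 4 → E) : Fin 3 → E) = ![a, c, d] := by
    ext i; fin_cases i <;> rfl
  have h2 : (Fin.removeNth (2 : Fin 4) (![a, b, c, d] : Fin 4 → E) : Fin 3 → E) = ![a, b, d] := by
    ext i; fin_cases i <;> rfl
  have h3 : (Fin.removeNth (3 : Fin 4) (![a, b, c, d] : Fin 4 → E) : Fin 3 → E) = ![a, b, c] := by
    ext i; fin_cases i <;> rfl
  rw [extDeriv, ContinuousAlternatingMap.alternatizeUncurryFin_apply, Fin.sum_univ_four, h0, h1,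
    h2, h3]
  simp [pow_succ]
  ring

/-- A 4-form `D` with `D(Ja, Jb, c, d) = D(a, b, c, d)` vanishes: `J` can be moved from one slot to
another at the cost of a sign, and there are three slots. -/
lemma alt4_eq_zero {J : E → E} (hJ : ∀ a, J (J a) = -a) {D : E [⋀^Fin 4]→L[ℝ] ℝ}
    (hD : ∀ a b c d, D ![J a, J b, c, d] = D ![a, b, c, d]) : D = 0 := by
  have h1 : ∀ a b c d, D ![J a, b, c, d] = -D ![a, J b, c, d] := fun a b c d => by
    have := hD (J a) b c d
    rw [hJ, alt_cons_neg] at this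
    linarith
  have h2 : ∀ a b c d, D ![a, J b, c, d] = -D ![a, b, J c, d] := fun a b c d => by
    have e4 := alt4_swap01 D a (J b) c d
    have e5 := alt4_swap01 D (J b) a c d
    have e6 := alt4_swap12 D (J b) a c d
    have e7 := alt4_swap01 D a b (J c) d
    have e8 := alt4_swap12 D b a (J c) d
    linarith [h1 b c a d]
  have h3 : ∀ a b c d, D ![J a, b, c, d] = -D ![a, b, J c, d] := fun a b c d => by
    have e1 := alt4_swap12 D (J a) b c d
    have e2 := alt4_swap12 D a b (J c) d
    linarith [h1 a c b d]
  have h4 : ∀ a b c d, D ![J a, b, c, d] = 0 := fun a b c d => by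
    linarith [h1 a b c d, h2 a b c d, h3 a b c d]
  ext v
  have h5 := h4 (J (J (J (v 0)))) (v 1) (v 2) (v 3)
  rw [hJ (J (J (v 0))), hJ (v 0), neg_neg] at h5
  have h7 : ![v 0, v 1, v 2, v 3] = v := by ext i; fin_cases i <;> rfl
  rw [h7] at h5
  simpa using h5

/-- Let `P` and `R = P(J·, ·, ·)` be the real part and (up to sign) the imaginary part of a
complex volume form of type `(3, 0)`. If `J` is integrable and `R` is closed, then `P` is closed:
integrability says that `dP + i dR` has type `(3, 1)`, and such a form vanishes if it is real. -/
lemma extDeriv_eq_zero_of_integrable {P R : E → E [⋀^Fin 3]→L[ℝ] ℝ} {J : E → E →L[ℝ] E} {x : E}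
    (hP : DifferentiableAt ℝ P x) (hR : DifferentiableAt ℝ R x) (hJ : DifferentiableAt ℝ J x)
    (hPR : ∀ᶠ y in 𝓝 x, ∀ a b c, P y ![J y a, b, c] = R y ![a, b, c])
    (hJ2 : ∀ᶠ y in 𝓝 x, ∀ a, J y (J y a) = -a)
    (hN : ∀ a b, fderiv ℝ J x (J x a) b - fderiv ℝ J x (J x b) a
      + J x (fderiv ℝ J x b a) - J x (fderiv ℝ J x a b) = 0)
    (hdR : extDeriv R x = 0) : extDeriv P x = 0 := by
  have hJ2x := hJ2.self_of_nhds
  have hPRx := hPR.self_of_nhds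
  have hJd : ∀ a, HasFDerivAt (fun y => J y a) ((fderiv ℝ J x).flip a) x := fun a => by
    have := hJ.hasFDerivAt.clm_apply (hasFDerivAt_const a x)
    simpa using this
  -- the derivatives of `P(J·, ·, ·) = R` and of `J² = -1`
  have e1 : ∀ u a b c, fderiv ℝ P x u ![J x a, b, c] + P x ![fderiv ℝ J x u a, b, c]
      = fderiv ℝ R x u ![a, b, c] := by
    intro u a b c
    have h1 : HasFDerivAt (interiorProd (fun y => J y a) P) _ x :=
      hasFDerivAt_interiorProd (hJd a).differentiableAt hP
    have h2 : HasFDerivAt (interiorProd (fun _ => a) R) _ x :=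
      hasFDerivAt_interiorProd (differentiableAt_const a) hR
    have h3 : interiorProd (fun y => J y a) P =ᶠ[𝓝 x] interiorProd (fun _ => a) R := by
      filter_upwards [hPR] with y hy
      ext v
      have : v = ![v 0, v 1] := by ext i; fin_cases i <;> rfl
      rw [this]
      exact hy a (v 0) (v 1)
    have h4 := congrArg (fun L => L u ![b, c]) (h1.unique (h2.congr_of_eventuallyEq h3))
    simp [(hJd a).fderiv] at h4
    linarith
  have e2 : ∀ u a, fderiv ℝ J x u (J x a) = -J x (fderiv ℝ J x u a) := by
    intro u a
    have h1 := hJ.hasFDerivAt.clm_apply (hJd a)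
    have h2 := h1.unique ((hasFDerivAt_const (-a) x).congr_of_eventuallyEq (by
      filter_upwards [hJ2] with y hy using hy a))
    have h3 := DFunLike.congr_fun h2 u
    simp at h3
    exact eq_neg_of_add_eq_zero_right h3
  have e3 : ∀ a b c, P x ![a, J x b, c] = P x ![J x a, b, c] := fun a b c => by
    rw [alt3_swap01, hPRx, hPRx, alt3_swap01]
    ring
  refine alt4_eq_zero (J := J x) hJ2x fun X Y Z W => ?_
  -- integrability turns `dR(JX, Y, Z, W) + dR(X, JY, Z, W)` into `dP(X, Y, Z, W) - dP(JX, JY, Z, W)`,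
  -- up to a sign
  have s1 := DFunLike.congr_fun hdR ![J x X, Y, Z, W]
  have s2 := DFunLike.congr_fun hdR ![X, J x Y, Z, W]
  rw [extDeriv_three_apply] at s1 s2
  rw [extDeriv_three_apply, extDeriv_three_apply]
  simp only [← e1, hJ2x, alt_cons_neg, e2, e3] at s1 s2
  have s3 : P x ![fderiv ℝ J x (J x X) Y, Z, W] - P x ![fderiv ℝ J x (J x Y) X, Z, W]
      + P x ![J x (fderiv ℝ J x Y X), Z, W] - P x ![J x (fderiv ℝ J x X Y), Z, W] = 0 := by
    have := congrArg (fun a => P x ![a, Z, W]) (hN X Y)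
    simp only [sub_eq_add_neg, alt_cons_add, alt_cons_neg] at this
    rw [show P x ![0, Z, W] = 0 from (P x).map_coord_zero 0 rfl] at this
    linarith
  simp at s1 s2
  have w1 := alt3_swap12 (fderiv ℝ P x W) (J x X) (J x Y) Z
  linarith

/-- The form of the Lefschetz theorem that is needed in real dimension 6. For a 2-form `F` and a
3-form `P` of type `(3, 0) + (0, 3)`, if `F ∧ σ = ι_u σ ∧ P` then `F = -ι_u P`. Contracting the
4-forms with the Kähler form over an orthonormal frame gives `(tr F) σ + 2 F = -2 ι_u P`, and a
second contraction gives `tr F = 0`. -/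
lemma eq_neg_of_wedge_eq {E : Type*} [NormedAddCommGroup E] [NormedSpace ℝ E]
    (hE : Module.finrank ℝ E = 6) {h : E →L[ℝ] E →L[ℝ] ℝ}
    (hsymm : ∀ a b, h a b = h b a) (hpos : ∀ a, a ≠ 0 → 0 < h a a) {J : E →L[ℝ] E}
    (hJ : ∀ a, J (J a) = -a) (hJh : ∀ a b, h (J a) (J b) = h a b) {σ F : E [⋀^Fin 2]→L[ℝ] ℝ}
    (hσ : ∀ a b, σ ![a, b] = h (J a) b) {P : E [⋀^Fin 3]→L[ℝ] ℝ}
    (hPJ : ∀ a b c, P ![J a, b, c] = P ![a, J b, c]) {u : E}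
    (hF : ∀ a b c d, F ![a, b] * σ ![c, d] - F ![a, c] * σ ![b, d] + F ![a, d] * σ ![b, c]
      + F ![b, c] * σ ![a, d] - F ![b, d] * σ ![a, c] + F ![c, d] * σ ![a, b]
      = σ ![u, a] * P ![b, c, d] - σ ![u, b] * P ![a, c, d] + σ ![u, c] * P ![a, b, d]
        - σ ![u, d] * P ![a, b, c]) (a b : E) :
    F ![a, b] = -P ![u, a, b] := by
  have : FiniteDimensional ℝ E := Module.finite_of_finrank_pos (by omega)
  obtain ⟨e, he1, he2⟩ := exists_orthonormal_frame
    ((ContinuousLinearMap.coeLM ℝ).comp (h : E →ₗ[ℝ] E →L[ℝ] ℝ)) hsymm hpos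
  replace he1 : ∀ i, h (e i) (e i) = 1 := he1
  replace he2 : ∀ x, x = ∑ i, h (e i) x • e i := he2
  have hcard : (Finset.univ : Finset (Fin (Module.finrank ℝ E))).card = 6 := by simp [hE]
  have frame : ∀ {n : ℕ} (f : E [⋀^Fin (n + 1)]→L[ℝ] ℝ) (x : E) (v : Fin n → E),
      ∑ i, h (e i) x * f (Matrix.vecCons (e i) v) = f (Matrix.vecCons x v) := by
    intro n f x v
    conv_rhs => rw [he2 x]
    rw [alt_cons_sum]
    exact Finset.sum_congr rfl fun i _ => (alt_cons_smul _ _ _ _).symm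
  have frameJ : ∀ {n : ℕ} (f : E [⋀^Fin (n + 1)]→L[ℝ] ℝ) (x : E) (v : Fin n → E),
      ∑ i, h (e i) x * f (Matrix.vecCons (J (e i)) v) = f (Matrix.vecCons (J x) v) := by
    intro n f x v
    conv_rhs => rw [he2 x, map_sum]
    simp only [map_smul]
    rw [alt_cons_sum]
    exact Finset.sum_congr rfl fun i _ => (alt_cons_smul _ _ _ _).symm
  have hJskew : ∀ a b, h (J a) b = -h a (J b) := fun a b => by
    rw [← hJh a, hJ, map_neg, neg_neg]
  have hPJ0 : ∀ i c, P ![e i, J (e i), c] = 0 := fun i c => by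
    have h1 := hPJ (e i) (e i) c
    have h2 := alt3_swap01 P (e i) (J (e i)) c
    linarith
  -- the trace of `F` with respect to the Kähler form
  set τ := ∑ i, F ![e i, J (e i)] with hτ
  have key : ∀ x y, τ * σ ![x, y] + 2 * F ![x, y] = -2 * P ![u, x, y] := by
    intro x y
    have h1 := Finset.sum_congr rfl fun i (_ : i ∈ Finset.univ) => hF (e i) (J (e i)) x y
    have h2 : ∀ i, F ![e i, J (e i)] * σ ![x, y] - F ![e i, x] * σ ![J (e i), y]
        + F ![e i, y] * σ ![J (e i), x] + F ![J (e i), x] * σ ![e i, y]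
        - F ![J (e i), y] * σ ![e i, x] + F ![x, y] * σ ![e i, J (e i)]
        = F ![e i, J (e i)] * σ ![x, y] + h (e i) y * F ![e i, x] - h (e i) x * F ![e i, y]
          - h (e i) (J y) * F ![J (e i), x] + h (e i) (J x) * F ![J (e i), y] + F ![x, y] := by
      intro i
      simp only [hσ, hJ, hJskew, he1, map_neg, _root_.neg_apply]
      ring
    have h3 : ∀ i, σ ![u, e i] * P ![J (e i), x, y] - σ ![u, J (e i)] * P ![e i, x, y]
        + σ ![u, x] * P ![e i, J (e i), y] - σ ![u, y] * P ![e i, J (e i), x]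
        = h (e i) (J u) * P ![J (e i), x, y] - h (e i) u * P ![e i, x, y] := by
      intro i
      rw [hPJ0, hPJ0, hσ, hσ, hJh, hsymm _ (e i), hsymm _ (e i)]
      ring
    simp only [h2, h3] at h1
    simp only [Finset.sum_add_distrib, Finset.sum_sub_distrib, frame, frameJ, ← Finset.sum_mul,
      ← hτ, hJ, alt_cons_neg, Finset.sum_const, hcard] at h1
    have h4 := alt2_swap F x y
    simp only [nsmul_eq_mul] at h1
    push_cast at h1
    linarith
  have hτ0 : τ = 0 := by
    have h1 := Finset.sum_congr rfl fun i (_ : i ∈ Finset.univ) => key (e i) (J (e i))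
    have h2 : ∀ i, P ![u, e i, J (e i)] = 0 := fun i => by
      have h3 := alt3_swap01 P u (e i) (J (e i))
      have h4 := alt3_swap12 P (e i) u (J (e i))
      linarith [hPJ0 i u]
    simp only [h2, hσ, hJh, he1, Finset.sum_add_distrib, ← Finset.mul_sum, ← hτ, Finset.sum_const,
      hcard, nsmul_eq_mul] at h1
    push_cast at h1
    linarith
  have h1 := key a b
  rw [hτ0] at h1
  linarith

end ComplexType

/-! ### Local sections of submersions and infinitesimal automorphisms -/

section LocalSection
open Filter Topology

/-- A submersion has smooth local sections. -/
lemma exists_local_section {E F : Type*} [NormedAddCommGroup E] [NormedSpace ℝ E]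
    [NormedAddCommGroup F] [NormedSpace ℝ F] [FiniteDimensional ℝ F] {p : E → F} {z : E}
    (hp : ContDiffAt ℝ ∞ p z) (hs : Function.Surjective (fderiv ℝ p z)) :
    ∃ f : F → E, ContDiffAt ℝ ∞ f (p z) ∧ f (p z) = z ∧ ∀ᶠ x in 𝓝 (p z), p (f x) = x := by
  have : CompleteSpace F := FiniteDimensional.complete ℝ F
  obtain ⟨r, hr⟩ := (fderiv ℝ p z : E →ₗ[ℝ] F).exists_rightInverse_of_surjective
    (LinearMap.range_eq_top.2 hs)
  set R : F →L[ℝ] E := LinearMap.toContinuousLinearMap r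
  have hR : ∀ x, fderiv ℝ p z (R x) = x := fun x => DFunLike.congr_fun hr x
  set q : F → F := fun x => p (z + R (x - p z)) with hq
  have hline : ContDiff ℝ ∞ fun x => z + R (x - p z) := by fun_prop
  have hpz : z + R (p z - p z) = z := by simp
  have hqs : ContDiffAt ℝ ∞ q (p z) := by
    refine ContDiffAt.comp (p z) ?_ hline.contDiffAt
    rwa [hpz]
  have hqd : HasFDerivAt q ((ContinuousLinearEquiv.refl ℝ F : F ≃L[ℝ] F) : F →L[ℝ] F) (p z) := by
    have h1 : HasFDerivAt p (fderiv ℝ p z) (z + R (p z - p z)) := by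
      rw [hpz]
      exact (hp.differentiableAt (by simp)).hasFDerivAt
    have h2 : HasFDerivAt (fun x => z + R (x - p z)) R (p z) :=
      (R.hasFDerivAt.comp (p z) ((hasFDerivAt_id (p z)).sub_const (p z))).const_add z
    refine (h1.comp (p z) h2).congr_fderiv ?_
    ext x
    exact hR x
  have hqz : q (p z) = p z := by simp [hq]
  have hn : (∞ : WithTop ℕ∞) ≠ 0 := by simp
  have hg := hqs.to_localInverse hqd hn
  have hgz := hqs.localInverse_apply_image hqd hn
  have hge := (hqs.hasStrictFDerivAt' hqd hn).eventually_right_inverse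
  rw [hqz] at hg hgz hge
  refine ⟨fun x => z + R (hqs.localInverse hqd hn x - p z), hline.contDiffAt.comp _ hg, ?_, hge⟩
  simp [hgz]

end LocalSection

section Rigidity
open Filter Topology

variable {E : Type*} [NormedAddCommGroup E] [NormedSpace ℝ E]

lemma IsG2Triple.comp {φ : E [⋀^Fin 3]→L[ℝ] ℝ} {k : E →L[ℝ] E →L[ℝ] ℝ}
    {χ : E [⋀^Fin 4]→L[ℝ] ℝ} (h : IsG2Triple φ k χ) (g : E ≃L[ℝ] E) :
    IsG2Triple (φ.compContinuousLinearMap (g : E →L[ℝ] E))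
      (k.bilinearComp (g : E →L[ℝ] E) (g : E →L[ℝ] E))
      (χ.compContinuousLinearMap (g : E →L[ℝ] E)) := by
  obtain ⟨e, hφ, hk, hχ⟩ := h
  exact ⟨g.trans e, fun v => hφ _, fun v w => hk _ _, fun v => hχ _⟩

/-- An infinitesimal automorphism `X` of the 3-form of a field of `G₂` structures preserves the
metric and the dual 4-form. -/
lemma flatLie_metric_eq_zero {φ : E → E [⋀^Fin 3]→L[ℝ] ℝ}
    {k : E → E →L[ℝ] E →L[ℝ] ℝ} {χ : E → E [⋀^Fin 4]→L[ℝ] ℝ}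
    {X : E → E} {z : E} (h : ∀ᶠ y in 𝓝 z, IsG2Triple (φ y) (k y) (χ y))
    (hφ : DifferentiableAt ℝ φ z) (hk : DifferentiableAt ℝ k z) (hχ : DifferentiableAt ℝ χ z)
    (hX : ∀ v, flatLie X φ z v = 0) :
    (∀ a b, fderiv ℝ k z (X z) a b + k z (fderiv ℝ X z a) b + k z a (fderiv ℝ X z b) = 0) ∧
      ∀ v, flatLie X χ z v = 0 := by
  obtain ⟨e, -⟩ := h.self_of_nhds
  have : FiniteDimensional ℝ E := e.symm.toLinearEquiv.finiteDimensional
  have : CompleteSpace E := FiniteDimensional.complete ℝ E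
  obtain ⟨D, hD, hD'⟩ := hasDerivAt_flatLie (X := X) hφ
  obtain ⟨D2, hD2, hD2'⟩ := hasDerivAt_bilinearComp (X := X) hk
  obtain ⟨D4, hD4, hD4'⟩ := hasDerivAt_flatLie (X := X) hχ
  have hD0 : D = 0 := by ext v; rw [hD, hX]; rfl
  rw [hD0] at hD'
  -- the pullbacks under `1 + s DX`, as substitutes for the pullbacks under the flow of `X`: they have
  -- the same derivative at `s = 0`
  have hev : ∀ᶠ s : ℝ in 𝓝 0, IsG2Triple
      ((φ (z + s • X z)).compContinuousLinearMap
        (ContinuousLinearMap.id ℝ E + s • fderiv ℝ X z))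
      ((k (z + s • X z)).bilinearComp (ContinuousLinearMap.id ℝ E + s • fderiv ℝ X z)
        (ContinuousLinearMap.id ℝ E + s • fderiv ℝ X z))
      ((χ (z + s • X z)).compContinuousLinearMap
        (ContinuousLinearMap.id ℝ E + s • fderiv ℝ X z)) := by
    have hc : Continuous fun s : ℝ => z + s • X z := by fun_prop
    have h1 : ∀ᶠ s : ℝ in 𝓝 0, IsG2Triple (φ (z + s • X z)) (k (z + s • X z)) (χ (z + s • X z)) :=
      hc.continuousAt.eventually (p := fun y => IsG2Triple (φ y) (k y) (χ y)) (by simpa using h)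
    filter_upwards [h1, eventually_id_add_smul_mem_range (fderiv ℝ X z)] with s hs1 hs2
    obtain ⟨g, hg⟩ := hs2
    rw [← hg]
    exact hs1.comp g
  obtain ⟨h1, h2⟩ := G2Triple_rigidity hev hD' hD2' hD4'
  exact ⟨fun a b => by rw [← hD2, h1]; rfl, fun v => by rw [← hD4, h2]; rfl⟩

end Rigidity

/-! ### The Kähler quotient in coordinates -/

section LocalModel
open Filter Topology

variable {E F : Type*} [NormedAddCommGroup E] [NormedSpace ℝ E]
  [NormedAddCommGroup F] [NormedSpace ℝ F]

/-- The expression in coordinates of a torsion-free `G₂` structure `(φ, k, χ)` with an infinitesimal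
automorphism `V` and of its Kähler quotient: `Ω` and `O` are the ranges of charts of the total space
and of the quotient, `p : Ω → O` is the projection, `t = |V|⁻¹`, `(h, J, σ)` is the Kähler structure
and `U` is the Hamiltonian vector field of `-t`. -/
structure LocalModel (Ω : Set E) (O : Set F) (φ : E → E [⋀^Fin 3]→L[ℝ] ℝ)
    (k : E → E →L[ℝ] E →L[ℝ] ℝ) (χ : E → E [⋀^Fin 4]→L[ℝ] ℝ) (V : E → E) (p : E → F)
    (t : F → ℝ) (h : F → F →L[ℝ] F →L[ℝ] ℝ) (J : F → F →L[ℝ] F) (σ : F → F [⋀^Fin 2]→L[ℝ] ℝ)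
    (U : F → F) : Prop where
  finrank_eq : Module.finrank ℝ F = 6
  isOpen_total : IsOpen Ω
  isOpen_base : IsOpen O
  mapsTo : Set.MapsTo p Ω O
  smooth_phi : ∀ z ∈ Ω, ContDiffAt ℝ ∞ φ z
  smooth_chi : ∀ z ∈ Ω, ContDiffAt ℝ ∞ χ z
  smooth_metric : ∀ z ∈ Ω, ContDiffAt ℝ ∞ k z
  smooth_V : ∀ z ∈ Ω, ContDiffAt ℝ ∞ V z
  smooth_p : ∀ z ∈ Ω, ContDiffAt ℝ ∞ p z
  closed_phi : ∀ z ∈ Ω, extDeriv φ z = 0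
  closed_chi : ∀ z ∈ Ω, extDeriv χ z = 0
  triple : ∀ z ∈ Ω, IsG2Triple (φ z) (k z) (χ z)
  lie_phi : ∀ z ∈ Ω, ∀ v, flatLie V φ z v = 0
  V_ne_zero : ∀ z ∈ Ω, V z ≠ 0
  surjective : ∀ z ∈ Ω, Function.Surjective (fderiv ℝ p z)
  ker : ∀ z ∈ Ω, ∀ v, fderiv ℝ p z v = 0 ↔ ∃ c : ℝ, v = c • V z
  smooth_t : ∀ x ∈ O, ContDiffAt ℝ ∞ t x
  t_eq : ∀ z ∈ Ω, t (p z) = (Real.sqrt (k z (V z) (V z)))⁻¹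
  metric_eq : ∀ z ∈ Ω, ∀ v w, k z (V z) v = 0 → k z (V z) w = 0 →
    k z v w = t (p z) * h (p z) (fderiv ℝ p z v) (fderiv ℝ p z w)
  form_eq : ∀ z ∈ Ω, ∀ v w, σ (p z) ![fderiv ℝ p z v, fderiv ℝ p z w] = φ z ![V z, v, w]
  h_symm : ∀ x ∈ O, ∀ a b, h x a b = h x b a
  h_pos : ∀ x ∈ O, ∀ a, a ≠ 0 → 0 < h x a a
  J_sq : ∀ x ∈ O, ∀ a, J x (J x a) = -a
  J_orthogonal : ∀ x ∈ O, ∀ a b, h x (J x a) (J x b) = h x a b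
  sigma_eq : ∀ x ∈ O, ∀ a b, σ x ![a, b] = h x (J x a) b
  differentiable_J : ∀ x ∈ O, DifferentiableAt ℝ J x
  smooth_sigma : ∀ x ∈ O, ContDiffAt ℝ ∞ σ x
  closed_sigma : ∀ x ∈ O, extDeriv σ x = 0
  nijenhuis : ∀ x ∈ O, ∀ a b, fderiv ℝ J x (J x a) b - fderiv ℝ J x (J x b) a
      + J x (fderiv ℝ J x b a) - J x (fderiv ℝ J x a b) = 0
  smooth_U : ∀ x ∈ O, ContDiffAt ℝ ∞ U x
  hamiltonian : ∀ x ∈ O, ∀ a, σ x ![U x, a] = -fderiv ℝ t x a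

namespace LocalModel

variable {Ω : Set E} {O : Set F} {φ : E → E [⋀^Fin 3]→L[ℝ] ℝ}
    {k : E → E →L[ℝ] E →L[ℝ] ℝ} {χ : E → E [⋀^Fin 4]→L[ℝ] ℝ} {V : E → E} {p : E → F}
    {t : F → ℝ} {h : F → F →L[ℝ] F →L[ℝ] ℝ} {J : F → F →L[ℝ] F} {σ : F → F [⋀^Fin 2]→L[ℝ] ℝ}
    {U : F → F}

variable (M : LocalModel Ω O φ k χ V p t h J σ U)
include M

lemma finiteDimensional_total {z : E} (hz : z ∈ Ω) : FiniteDimensional ℝ E := by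
  obtain ⟨e, -⟩ := M.triple z hz
  exact e.symm.toLinearEquiv.finiteDimensional

lemma finiteDimensional_base : FiniteDimensional ℝ F :=
  Module.finite_of_finrank_pos (by rw [M.finrank_eq]; norm_num)

lemma metric_V_pos {z : E} (hz : z ∈ Ω) : 0 < k z (V z) (V z) :=
  (M.triple z hz).pos (M.V_ne_zero z hz)

lemma t_pos {z : E} (hz : z ∈ Ω) : 0 < t (p z) := by
  rw [M.t_eq z hz]
  exact inv_pos.2 (Real.sqrt_pos.2 (M.metric_V_pos hz))

lemma t_sq_mul {z : E} (hz : z ∈ Ω) : t (p z) ^ 2 * k z (V z) (V z) = 1 := by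
  rw [M.t_eq z hz, inv_pow, Real.sq_sqrt (M.metric_V_pos hz).le,
    inv_mul_cancel₀ (M.metric_V_pos hz).ne']

lemma proj_V {z : E} (hz : z ∈ Ω) : fderiv ℝ p z (V z) = 0 :=
  (M.ker z hz _).2 ⟨1, (one_smul _ _).symm⟩

lemma horizontal_ext {z : E} (hz : z ∈ Ω) {v w : E} (hv : k z (V z) v = 0) (hw : k z (V z) w = 0)
    (hvw : fderiv ℝ p z v = fderiv ℝ p z w) : v = w := by
  obtain ⟨c, hc⟩ := (M.ker z hz (v - w)).1 (by rw [map_sub, hvw, sub_self])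
  have h1 : k z (V z) (v - w) = 0 := by rw [map_sub, hv, hw, sub_self]
  rw [hc, map_smul, smul_eq_mul, mul_eq_zero, or_iff_left (M.metric_V_pos hz).ne'] at h1
  rw [h1, zero_smul] at hc
  exact sub_eq_zero.1 hc

/-- The lift of `J` to horizontal vectors is `t V ×`, where `×` is the cross product of the `G₂`
structure; hence the relation between `φ` and `ι_V χ` on horizontal vectors. -/
lemma exists_lift_J {z : E} (hz : z ∈ Ω) (v : E) :
    ∃ v' : E, k z (V z) v' = 0 ∧ fderiv ℝ p z v' = J (p z) (fderiv ℝ p z v) ∧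
      ∀ a b, k z (V z) a = 0 → k z (V z) b = 0 →
        φ z ![v', a, b] = t (p z) * χ z ![V z, v, a, b] := by
  obtain ⟨c, hc1, hc2⟩ := (M.triple z hz).exists_cross
  have hsym := (M.triple z hz).symm
  set w := c (V z) v with hw
  have hwV : k z (V z) w = 0 := by
    rw [hsym, hw, hc1]
    exact (φ z).map_eq_zero_of_eq _ (i := 0) (j := 2) (by simp) (by decide)
  refine ⟨t (p z) • w, by rw [map_smul, hwV, smul_zero], ?_, fun a b ha hb => ?_⟩
  · rw [map_smul]
    by_contra hne
    set d := t (p z) • fderiv ℝ p z w - J (p z) (fderiv ℝ p z v) with hd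
    have hd0 : d ≠ 0 := sub_ne_zero.2 hne
    have hx := M.mapsTo hz
    refine (M.h_pos _ hx d hd0).ne' ?_
    -- pair the difference `d` of the two sides with a horizontal vector `y` over `d`
    obtain ⟨y0, hy0⟩ := M.surjective z hz d
    set y := y0 - (t (p z) ^ 2 * k z (V z) y0) • V z with hy
    have hyV : k z (V z) y = 0 := by
      rw [hy, map_sub, map_smul, smul_eq_mul]
      linear_combination (-k z (V z) y0) * M.t_sq_mul hz
    have hyp : fderiv ℝ p z y = d := by rw [hy, map_sub, map_smul, M.proj_V hz, hy0]; simp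
    have h1 : φ z ![V z, v, y] = t (p z) * h (p z) (fderiv ℝ p z w) d := by
      rw [← hc1, M.metric_eq z hz _ _ hwV hyV, hyp]
    have h2 : φ z ![V z, v, y] = h (p z) (J (p z) (fderiv ℝ p z v)) d := by
      rw [← M.form_eq z hz, hyp, M.sigma_eq _ hx]
    rw [h1] at h2
    have h3 : h (p z) d = t (p z) • h (p z) (fderiv ℝ p z w)
        - h (p z) (J (p z) (fderiv ℝ p z v)) := by rw [hd, map_sub, map_smul]
    rw [h3]
    exact sub_eq_zero.2 h2
  · have h1 := hc2 (V z) v a b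
    rw [ha, hb] at h1
    have h2 := alt3_swap12 (φ z) a b w
    have h3 := alt3_swap01 (φ z) a w b
    rw [alt_cons_smul, hw] at *
    have h4 : φ z ![c (V z) v, a, b] = χ z ![V z, v, a, b] := by linarith
    rw [h4]

lemma eventually_mem {z : E} (hz : z ∈ Ω) : ∀ᶠ y in 𝓝 z, y ∈ Ω := M.isOpen_total.mem_nhds hz

lemma lie_metric_chi {X : E → E} {z : E} (hz : z ∈ Ω) (hX : ∀ v, flatLie X φ z v = 0) :
    (∀ a b, fderiv ℝ k z (X z) a b + k z (fderiv ℝ X z a) b + k z a (fderiv ℝ X z b) = 0) ∧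
      ∀ v, flatLie X χ z v = 0 :=
  flatLie_metric_eq_zero ((M.eventually_mem hz).mono M.triple)
    ((M.smooth_phi z hz).differentiableAt (by simp))
    ((M.smooth_metric z hz).differentiableAt (by simp))
    ((M.smooth_chi z hz).differentiableAt (by simp)) hX

/-- `d ι_V χ = L_V χ - ι_V dχ = 0`. -/
lemma extDeriv_interior_chi {z : E} (hz : z ∈ Ω) : extDeriv (interiorProd V χ) z = 0 := by
  ext v
  have h1 := extDeriv_interiorProd_add ((M.smooth_V z hz).differentiableAt (by simp))
    ((M.smooth_chi z hz).differentiableAt (by simp)) v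
  rw [(M.lie_metric_chi hz (M.lie_phi z hz)).2, M.closed_chi z hz] at h1
  simpa using h1

end LocalModel
end LocalModel

/-! ### Horizontal lifts along a section -/

section Horizontal
open Filter Topology

variable {E F : Type*} [NormedAddCommGroup E] [NormedSpace ℝ E]
  [NormedAddCommGroup F] [NormedSpace ℝ F]

lemma alt3_add_smul (f : E [⋀^Fin 3]→L[ℝ] ℝ) (a b c v : E) (r s q : ℝ) :
    f ![a + r • v, b + s • v, c + q • v] = f ![a, b, c] + r * f ![v, b, c] - s * f ![v, a, c]
      + q * f ![v, a, b] := by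
  have add1 : ∀ a b y z : E, f ![y, a + b, z] = f ![y, a, z] + f ![y, b, z] := fun a b y z => by
    rw [alt3_swap01, alt_cons_add, alt3_swap01 f a, alt3_swap01 f b]; ring
  have add2 : ∀ a b y z : E, f ![y, z, a + b] = f ![y, z, a] + f ![y, z, b] := fun a b y z => by
    rw [alt3_swap12, add1, alt3_swap12 f y a, alt3_swap12 f y b]; ring
  have smul1 : ∀ (r : ℝ) (a y z : E), f ![y, r • a, z] = r * f ![y, a, z] := fun r a y z => by
    rw [alt3_swap01, alt_cons_smul, alt3_swap01 f a]; ring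
  have smul2 : ∀ (r : ℝ) (a y z : E), f ![y, z, r • a] = r * f ![y, z, a] := fun r a y z => by
    rw [alt3_swap12, smul1, alt3_swap12 f y a]; ring
  have z1 : ∀ y, f ![v, v, y] = 0 := fun y => by linarith [alt3_swap01 f v v y]
  have z2 : ∀ y, f ![y, v, v] = 0 := fun y => by linarith [alt3_swap12 f y v v]
  have z3 : ∀ y, f ![v, y, v] = 0 := fun y => by
    linarith [alt3_swap12 f v y v, z1 y]
  simp only [alt_cons_add, alt_cons_smul, add1, add2, smul1, smul2, z1, z2, z3]
  rw [alt3_swap01 f a v c, alt3_swap12 f a b v, alt3_swap01 f a v b]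
  ring

/-- The pullback by the section `f` of the connection 1-form `t² k(V, ·)`. -/
def connForm (k : E → E →L[ℝ] E →L[ℝ] ℝ) (V : E → E) (t : F → ℝ) (f : F → E) (x : F) : F →L[ℝ] ℝ :=
  t x ^ 2 • (k (f x) (V (f x)) ∘L fderiv ℝ f x)

/-- The horizontal lift `a ↦ f_* a - A(a) V` of vectors at the points of the section `f`, where `A`
is the pulled back connection form. -/
def horLift (k : E → E →L[ℝ] E →L[ℝ] ℝ) (V : E → E) (t : F → ℝ) (f : F → E) (x : F) : F →L[ℝ] E :=
  fderiv ℝ f x - (connForm k V t f x).smulRight (V (f x))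

namespace LocalModel

variable {Ω : Set E} {O : Set F} {φ : E → E [⋀^Fin 3]→L[ℝ] ℝ}
    {k : E → E →L[ℝ] E →L[ℝ] ℝ} {χ : E → E [⋀^Fin 4]→L[ℝ] ℝ} {V : E → E} {p : E → F}
    {t : F → ℝ} {h : F → F →L[ℝ] F →L[ℝ] ℝ} {J : F → F →L[ℝ] F} {σ : F → F [⋀^Fin 2]→L[ℝ] ℝ}
    {U : F → F}

variable (M : LocalModel Ω O φ k χ V p t h J σ U)
include M

lemma proj_section {f : F → E} {x : F} (hx : f x ∈ Ω) (hf : DifferentiableAt ℝ f x)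
    (hpf : ∀ᶠ y in 𝓝 x, p (f y) = y) (a : F) : fderiv ℝ p (f x) (fderiv ℝ f x a) = a := by
  have h1 := ((M.smooth_p _ hx).differentiableAt (by simp)).hasFDerivAt.comp x
    hf.hasFDerivAt
  have h2 := h1.unique ((hasFDerivAt_id x).congr_of_eventuallyEq hpf)
  exact DFunLike.congr_fun h2 a

lemma proj_horLift {f : F → E} {x : F} (hx : f x ∈ Ω) (hf : DifferentiableAt ℝ f x)
    (hpf : ∀ᶠ y in 𝓝 x, p (f y) = y) (a : F) : fderiv ℝ p (f x) (horLift k V t f x a) = a := by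
  rw [horLift, _root_.sub_apply, ContinuousLinearMap.smulRight_apply, map_sub, map_smul,
    M.proj_V hx, M.proj_section hx hf hpf, smul_zero, sub_zero]

lemma metric_V_horLift {f : F → E} {x : F} (hx : f x ∈ Ω)
    (hpx : p (f x) = x) (a : F) : k (f x) (V (f x)) (horLift k V t f x a) = 0 := by
  have h1 := M.t_sq_mul hx
  rw [hpx] at h1
  simp only [horLift, connForm, _root_.sub_apply, ContinuousLinearMap.smulRight_apply, map_sub,
    map_smul, _root_.smul_apply, ContinuousLinearMap.comp_apply, smul_eq_mul]
  linear_combination -(k (f x) (V (f x)) (fderiv ℝ f x a)) * h1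

omit M in
lemma push_eq_horLift_add (f : F → E) (x a : F) :
    fderiv ℝ f x a = horLift k V t f x a + connForm k V t f x a • V (f x) := by
  simp [horLift]

lemma smooth_connForm {f : F → E} {x : F} (hx : f x ∈ Ω) (hf : ContDiffAt ℝ ∞ f x)
    (hpx : p (f x) = x) : ContDiffAt ℝ ∞ (connForm k V t f) x := by
  have hxO : x ∈ O := hpx ▸ M.mapsTo hx
  have h1 : ContDiffAt ℝ ∞ (fun x => k (f x) (V (f x))) x :=
    ((M.smooth_metric _ hx).comp x hf).clm_apply ((M.smooth_V _ hx).comp x hf)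
  exact ((M.smooth_t x hxO).pow 2).smul (h1.clm_comp (hf.fderiv_right (m := ∞) (by simp)))

lemma smooth_horLift {f : F → E} {x : F} (hx : f x ∈ Ω) (hf : ContDiffAt ℝ ∞ f x)
    (hpx : p (f x) = x) : ContDiffAt ℝ ∞ (horLift k V t f) x :=
  (hf.fderiv_right (m := ∞) (by simp)).sub
    ((M.smooth_connForm hx hf hpx).smulRight ((M.smooth_V _ hx).comp x hf))

end LocalModel
end Horizontal

/-! ### The curvature of the connection -/

section Curvature
open Filter Topology

variable {E F : Type*} [NormedAddCommGroup E] [NormedSpace ℝ E]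
  [NormedAddCommGroup F] [NormedSpace ℝ F]

variable (E) in
/-- A linear form, as an alternating form. -/
def oneForm : (E →L[ℝ] ℝ) →L[ℝ] E [⋀^Fin 1]→L[ℝ] ℝ :=
  (ContinuousAlternatingMap.ofSubsingletonLIE (𝕜 := ℝ) (E := E) (F := ℝ)
    (0 : Fin 1)).toContinuousLinearEquiv.toContinuousLinearMap

lemma extDeriv_oneForm {A : E → E →L[ℝ] ℝ} {x : E} (hA : DifferentiableAt ℝ A x) (a b : E) :
    extDeriv (fun y => oneForm E (A y)) x ![a, b] = fderiv ℝ A x a b - fderiv ℝ A x b a := by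
  have h1 : HasFDerivAt (fun y => oneForm E (A y)) (oneForm E ∘L fderiv ℝ A x) x :=
    HasFDerivAt.comp x (g := oneForm E) (ContinuousLinearMap.hasFDerivAt _) hA.hasFDerivAt
  rw [extDeriv_one_apply, h1.fderiv]
  rfl

/-- The restriction of `t⁻¹ φ` to horizontal vectors, as a form on the base. It is the real part of
a form of type `(3, 0)`. -/
def realForm (φ : E → E [⋀^Fin 3]→L[ℝ] ℝ) (k : E → E →L[ℝ] E →L[ℝ] ℝ) (V : E → E) (t : F → ℝ)
    (f : F → E) (x : F) : F [⋀^Fin 3]→L[ℝ] ℝ :=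
  (t x)⁻¹ • (φ (f x)).compContinuousLinearMap (horLift k V t f x)

lemma realForm_apply (φ : E → E [⋀^Fin 3]→L[ℝ] ℝ) (k : E → E →L[ℝ] E →L[ℝ] ℝ) (V : E → E)
    (t : F → ℝ) (f : F → E) (x : F) (a b c : F) :
    realForm φ k V t f x ![a, b, c] = (t x)⁻¹ * φ (f x) ![horLift k V t f x a,
      horLift k V t f x b, horLift k V t f x c] := by
  rw [← comp_vec3]; rfl

namespace LocalModel

variable {Ω : Set E} {O : Set F} {φ : E → E [⋀^Fin 3]→L[ℝ] ℝ}
    {k : E → E →L[ℝ] E →L[ℝ] ℝ} {χ : E → E [⋀^Fin 4]→L[ℝ] ℝ} {V : E → E} {p : E → F}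
    {t : F → ℝ} {h : F → F →L[ℝ] F →L[ℝ] ℝ} {J : F → F →L[ℝ] F} {σ : F → F [⋀^Fin 2]→L[ℝ] ℝ}
    {U : F → F} {f : F → E} {x : F}

variable (M : LocalModel Ω O φ k χ V p t h J σ U)
include M

lemma eventually_section (hx : f x ∈ Ω) (hf : ContDiffAt ℝ ∞ f x)
    (hpf : ∀ᶠ y in 𝓝 x, p (f y) = y) :
    ∀ᶠ y in 𝓝 x, f y ∈ Ω ∧ DifferentiableAt ℝ f y ∧ ∀ᶠ y' in 𝓝 y, p (f y') = y' := by
  have h1 : ∀ᶠ y in 𝓝 x, ContDiffAt ℝ 1 f y := (hf.of_le (by simp)).eventually (by simp)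
  filter_upwards [hf.continuousAt.eventually_mem (M.isOpen_total.mem_nhds hx), h1,
    hpf.eventually_nhds] with y h1 h2 h3
  exact ⟨h1, h2.differentiableAt (by simp), h3⟩

lemma differentiableAt_realForm (hx : f x ∈ Ω) (hf : ContDiffAt ℝ ∞ f x) (hpx : p (f x) = x) :
    DifferentiableAt ℝ (realForm φ k V t f) x := by
  have hxO : x ∈ O := hpx ▸ M.mapsTo hx
  have h0 : t x ≠ 0 := by rw [← hpx]; exact (M.t_pos hx).ne'
  have h1 : DifferentiableAt ℝ (fun x => φ (f x)) x :=
    (((M.smooth_phi _ hx).comp x hf).differentiableAt (by simp))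
  exact (((M.smooth_t x hxO).differentiableAt (by simp)).inv h0).smul
    (h1.continuousAlternatingMapCompContinuousLinearMap
      ((M.smooth_horLift hx hf hpx).differentiableAt (by simp)))

/-- The closed form `ι_V χ` is the imaginary part, up to sign, of the form whose real part is
`realForm`. -/
lemma realForm_J (hx : f x ∈ Ω) (hf : DifferentiableAt ℝ f x)
    (hpf : ∀ᶠ y in 𝓝 x, p (f y) = y) (a b c : F) :
    realForm φ k V t f x ![J x a, b, c]
      = (interiorProd V χ (f x)).compContinuousLinearMap (fderiv ℝ f x) ![a, b, c] := by
  have hpx := hpf.self_of_nhds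
  obtain ⟨v', h1, h2, h3⟩ := M.exists_lift_J hx (horLift k V t f x a)
  rw [M.proj_horLift hx hf hpf, hpx] at h2
  have h4 : v' = horLift k V t f x (J x a) :=
    M.horizontal_ext hx h1 (M.metric_V_horLift hx hpx _) (by rw [h2, M.proj_horLift hx hf hpf])
  have h0 : t x ≠ 0 := by rw [← hpx]; exact (M.t_pos hx).ne'
  rw [realForm_apply, ← h4, h3 _ _ (M.metric_V_horLift hx hpx _) (M.metric_V_horLift hx hpx _), hpx,
    inv_mul_cancel_left₀ h0, ContinuousAlternatingMap.compContinuousLinearMap_apply, show (⇑(fderiv ℝ f x) ∘ ![a, b, c] : Fin 3 → E) = _ from comp_vec3 _ a b c]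
  have e := fun a => push_eq_horLift_add (k := k) (V := V) (t := t) f x a
  rw [e a, e b, e c, alt3_add_smul]
  have z : ∀ b c, interiorProd V χ (f x) ![V (f x), b, c] = 0 := fun b c =>
    (χ (f x)).map_eq_zero_of_eq _ (i := 0) (j := 1) (by simp) (by decide)
  rw [z, z, z]
  simp [interiorProd_apply]

lemma extDeriv_realForm (hx : f x ∈ Ω) (hf : ContDiffAt ℝ ∞ f x)
    (hpf : ∀ᶠ y in 𝓝 x, p (f y) = y) : extDeriv (realForm φ k V t f) x = 0 := by
  have hpx := hpf.self_of_nhds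
  have hxO : x ∈ O := hpx ▸ M.mapsTo hx
  have hR : DifferentiableAt ℝ (interiorProd V χ) (f x) :=
    (contDiffAt_interiorProd (M.smooth_V _ hx) (M.smooth_chi _ hx)).differentiableAt (by simp)
  have hfd : DifferentiableAt ℝ (fderiv ℝ f) x :=
    (hf.fderiv_right (m := ∞) (by simp)).differentiableAt (by simp)
  refine extDeriv_eq_zero_of_integrable (M.differentiableAt_realForm hx hf hpx)
    (R := fun x => (interiorProd V χ (f x)).compContinuousLinearMap (fderiv ℝ f x)) ?_
    (M.differentiable_J x hxO) ?_ ?_ (M.nijenhuis x hxO) ?_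
  · exact DifferentiableAt.continuousAlternatingMapCompContinuousLinearMap
      (hR.comp x (hf.differentiableAt (by simp))) hfd
  · filter_upwards [M.eventually_section hx hf hpf] with y hy a b c
      using M.realForm_J hy.1 hy.2.1 hy.2.2 a b c
  · filter_upwards [M.isOpen_base.mem_nhds hxO] with y hy a using M.J_sq y hy a
  · rw [extDeriv_pullback hR (hf.of_le (m := 2) ENat.LEInfty.out)
      minSmoothness_of_isRCLikeNormedField.le, M.extDeriv_interior_chi hx]
    rfl

/-- `φ = θ ∧ σ + t Re Ψ`, pulled back by a section. -/
lemma phi_push (hx : f x ∈ Ω) (hf : DifferentiableAt ℝ f x)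
    (hpf : ∀ᶠ y in 𝓝 x, p (f y) = y) (a b c : F) :
    (φ (f x)).compContinuousLinearMap (fderiv ℝ f x) ![a, b, c]
      = connForm k V t f x a * σ x ![b, c] - connForm k V t f x b * σ x ![a, c]
        + connForm k V t f x c * σ x ![a, b] + t x * realForm φ k V t f x ![a, b, c] := by
  have hpx := hpf.self_of_nhds
  have h0 : t x ≠ 0 := by rw [← hpx]; exact (M.t_pos hx).ne'
  have e := fun a => push_eq_horLift_add (k := k) (V := V) (t := t) f x a
  rw [ContinuousAlternatingMap.compContinuousLinearMap_apply, show (⇑(fderiv ℝ f x) ∘ ![a, b, c] : Fin 3 → E) = _ from comp_vec3 _ a b c, e a, e b, e c,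
    alt3_add_smul, realForm_apply, mul_inv_cancel_left₀ h0]
  have z : ∀ b c, φ (f x) ![V (f x), horLift k V t f x b, horLift k V t f x c] = σ x ![b, c] := by
    intro b c
    rw [← M.form_eq _ hx, M.proj_horLift hx hf hpf, M.proj_horLift hx hf hpf, hpx]
  rw [z, z, z]
  ring

/-- The curvature of the connection is minus the contraction with `U` of the real part of the
complex volume form: differentiate `φ = A ∧ σ + t Re Ψ`. -/
lemma curvature (hx : f x ∈ Ω) (hf : ContDiffAt ℝ ∞ f x)
    (hpf : ∀ᶠ y in 𝓝 x, p (f y) = y) (a b : F) :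
    fderiv ℝ (connForm k V t f) x a b - fderiv ℝ (connForm k V t f) x b a
      = -realForm φ k V t f x ![U x, a, b] := by
  have hpx := hpf.self_of_nhds
  have hxO : x ∈ O := hpx ▸ M.mapsTo hx
  have hA := (M.smooth_connForm hx hf hpx).differentiableAt (by simp)
  have hP := M.differentiableAt_realForm hx hf hpx
  have ht := (M.smooth_t x hxO).differentiableAt (by simp)
  have hσ := (M.smooth_sigma x hxO).differentiableAt (by simp)
  have hfd : DifferentiableAt ℝ (fderiv ℝ f) x :=
    (hf.fderiv_right (m := ∞) (by simp)).differentiableAt (by simp)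
  have hφ := (M.smooth_phi _ hx).differentiableAt (by simp)
  set A := connForm k V t f with hAdef
  set P := realForm φ k V t f with hPdef
  set G := fun x => (φ (f x)).compContinuousLinearMap (fderiv ℝ f x) with hGdef
  have hG : DifferentiableAt ℝ G x :=
    DifferentiableAt.continuousAlternatingMapCompContinuousLinearMap
      (hφ.comp x (hf.differentiableAt (by simp))) hfd
  have hdG : extDeriv G x = 0 := by
    rw [extDeriv_pullback hφ (hf.of_le (m := 2) ENat.LEInfty.out)
      minSmoothness_of_isRCLikeNormedField.le, M.closed_phi _ hx]
    rfl
  have hdP : extDeriv P x = 0 := M.extDeriv_realForm hx hf hpf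
  have hds := M.closed_sigma x hxO
  -- evaluation of forms on constant vectors commutes with differentiation
  have ev : ∀ {n : ℕ} {B : F → F [⋀^Fin n]→L[ℝ] ℝ} (_ : DifferentiableAt ℝ B x) (v : Fin n → F),
      HasFDerivAt (fun y => B y v)
        ((ContinuousAlternatingMap.apply ℝ F ℝ v).comp (fderiv ℝ B x)) x := fun hB v =>
    HasFDerivAt.comp x (g := ContinuousAlternatingMap.apply ℝ F ℝ v)
      (ContinuousLinearMap.hasFDerivAt _) hB.hasFDerivAt
  have evA : ∀ a : F, HasFDerivAt (fun y => A y a) ((fderiv ℝ A x).flip a) x := fun a => by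
    simpa using hA.hasFDerivAt.clm_apply (hasFDerivAt_const a x)
  have key : ∀ u a b c, fderiv ℝ G x u ![a, b, c]
      = fderiv ℝ A x u a * σ x ![b, c] + A x a * fderiv ℝ σ x u ![b, c]
        - (fderiv ℝ A x u b * σ x ![a, c] + A x b * fderiv ℝ σ x u ![a, c])
        + (fderiv ℝ A x u c * σ x ![a, b] + A x c * fderiv ℝ σ x u ![a, b])
        + (fderiv ℝ t x u * P x ![a, b, c] + t x * fderiv ℝ P x u ![a, b, c]) := by
    intro u a b c
    have h1 := ev hG ![a, b, c]
    have h2 := ((((evA a).mul (ev hσ ![b, c])).sub ((evA b).mul (ev hσ ![a, c]))).add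
      ((evA c).mul (ev hσ ![a, b]))).add (ht.hasFDerivAt.mul (ev hP ![a, b, c]))
    have h3 := h1.unique (h2.congr_of_eventuallyEq (by
      filter_upwards [M.eventually_section hx hf hpf] with y hy
        using M.phi_push hy.1 hy.2.1 hy.2.2 a b c))
    have h4 := DFunLike.congr_fun h3 u
    simp at h4
    rw [h4]
    ring
  have hFd := extDeriv_oneForm hA
  rw [← hFd]
  refine eq_neg_of_wedge_eq M.finrank_eq (M.h_symm x hxO) (M.h_pos x hxO) (M.J_sq x hxO)
    (M.J_orthogonal x hxO) (M.sigma_eq x hxO) (fun a b c => ?_) (fun a b c d => ?_) a b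
  · rw [M.realForm_J hx (hf.differentiableAt (by simp)) hpf, alt3_swap01,
      alt3_swap01 (P x), M.realForm_J hx (hf.differentiableAt (by simp)) hpf]
  · have d1 := DFunLike.congr_fun hdG ![a, b, c, d]
    have d2 := DFunLike.congr_fun hdP ![a, b, c, d]
    rw [extDeriv_three_apply] at d1 d2
    simp only [key] at d1
    have d3 : ∀ a b c, _ := fun a b c => DFunLike.congr_fun hds ![a, b, c]
    simp only [extDeriv_two_apply] at d3
    simp only [hFd, M.hamiltonian x hxO]
    change _ = (0 : ℝ) at d1
    change _ = (0 : ℝ) at d2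
    replace d3 : ∀ a b c, fderiv ℝ σ x a ![b, c] - fderiv ℝ σ x b ![a, c]
        + fderiv ℝ σ x c ![a, b] = 0 := d3
    linear_combination d1 - t x * d2 + A x a * d3 b c d - A x b * d3 a c d + A x c * d3 a b d
      - A x d * d3 a b c

end LocalModel
end Curvature

/-! ### The horizontal lift of the Hamiltonian field -/

section Lift
open Filter Topology

variable {E F : Type*} [NormedAddCommGroup E] [NormedSpace ℝ E]
  [NormedAddCommGroup F] [NormedSpace ℝ F]

/-- The 1-form `t θ`, where `θ = t² k(V, ·)` is the connection form: a potential of `-ι_W φ` for the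
horizontal lift `W` of the Hamiltonian field. -/
def potential (k : E → E →L[ℝ] E →L[ℝ] ℝ) (V : E → E) (p : E → F) (t : F → ℝ) (z : E) : E →L[ℝ] ℝ :=
  t (p z) ^ 3 • k z (V z)

namespace LocalModel

variable {Ω : Set E} {O : Set F} {φ : E → E [⋀^Fin 3]→L[ℝ] ℝ}
    {k : E → E →L[ℝ] E →L[ℝ] ℝ} {χ : E → E [⋀^Fin 4]→L[ℝ] ℝ} {V : E → E} {p : E → F}
    {t : F → ℝ} {h : F → F →L[ℝ] F →L[ℝ] ℝ} {J : F → F →L[ℝ] F} {σ : F → F [⋀^Fin 2]→L[ℝ] ℝ}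
    {U : F → F} {W : E → E} {z : E}

variable (M : LocalModel Ω O φ k χ V p t h J σ U)
include M

lemma smooth_potential (hz : z ∈ Ω) : ContDiffAt ℝ ∞ (potential k V p t) z :=
  (((M.smooth_t _ (M.mapsTo hz)).comp z (M.smooth_p z hz)).pow 3).smul
    ((M.smooth_metric z hz).clm_apply (M.smooth_V z hz))

lemma fderiv_t_comp (hz : z ∈ Ω) :
    HasFDerivAt (fun y => t (p y)) (fderiv ℝ t (p z) ∘L fderiv ℝ p z) z :=
  ((M.smooth_t _ (M.mapsTo hz)).differentiableAt (by simp)).hasFDerivAt.comp z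
    ((M.smooth_p z hz).differentiableAt (by simp)).hasFDerivAt

/-- `ι_V d(t θ) = L_V (t θ) - d(t θ(V)) = -dt`, as `V` preserves `t θ` and `θ(V) = 1`. -/
lemma extDeriv_potential_V (hz : z ∈ Ω) (b : E) :
    extDeriv (fun y => oneForm E (potential k V p t y)) z ![V z, b]
      = -fderiv ℝ t (p z) (fderiv ℝ p z b) := by
  have hV := ((M.smooth_V z hz).differentiableAt (by simp)).hasFDerivAt
  have hk := ((M.smooth_metric z hz).differentiableAt (by simp)).hasFDerivAt
  have ht := M.fderiv_t_comp hz
  have hη : DifferentiableAt ℝ (potential k V p t) z :=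
    (M.smooth_potential hz).differentiableAt (by simp)
  rw [extDeriv_oneForm hη]
  have h1 : HasFDerivAt (potential k V p t) _ z := (ht.pow 3).smul (hk.clm_apply hV)
  have h2 : HasFDerivAt (fun y => potential k V p t y (V y)) _ z := hη.hasFDerivAt.clm_apply hV
  have h3 : (fun y => potential k V p t y (V y)) =ᶠ[𝓝 z] fun y => t (p y) := by
    filter_upwards [M.eventually_mem hz] with y hy
    have := M.t_sq_mul hy
    simp only [potential, _root_.smul_apply, smul_eq_mul]
    linear_combination t (p y) * this
  have h4 := DFunLike.congr_fun (h2.unique (ht.congr_of_eventuallyEq h3)) b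
  have h5 := (M.lie_metric_chi hz (M.lie_phi z hz)).1 (V z) b
  have h6 := congrArg (fun L => L (V z) b) h1.fderiv
  simp [M.proj_V hz] at h6
  simp at h4
  have h7 : potential k V p t z (fderiv ℝ V z b) = t (p z) ^ 3 * k z (V z) (fderiv ℝ V z b) := rfl
  rw [h7] at h4
  rw [h6]
  linear_combination t (p z) ^ 3 * h5 - h4

/-- The form `ι_W φ` is exact, for `W` the horizontal lift of the Hamiltonian field. Both sides are
compared on pairs of vectors tangent to a section, by the curvature formula, and on pairs that
contain `V`. -/
lemma interior_phi_eq (hz : z ∈ Ω) (hW : fderiv ℝ p z (W z) = U (p z))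
    (hW0 : k z (V z) (W z) = 0) :
    interiorProd W φ z = -extDeriv (fun y => oneForm E (potential k V p t y)) z := by
  have := M.finiteDimensional_base
  obtain ⟨f, hf, hfz, hpf⟩ := exists_local_section (M.smooth_p z hz) (M.surjective z hz)
  set x := p z with hx
  have hz' : f x ∈ Ω := hfz.symm ▸ hz
  have hpx : p (f x) = x := by rw [hfz]
  have hxO := M.mapsTo hz
  have hfd : DifferentiableAt ℝ f x := hf.differentiableAt (by simp)
  set η := fun y => oneForm E (potential k V p t y) with hη
  have hηs : DifferentiableAt ℝ (potential k V p t) (f x) :=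
    (M.smooth_potential hz').differentiableAt (by simp)
  have hηd : DifferentiableAt ℝ η (f x) :=
    DifferentiableAt.comp (f x) (g := oneForm E) (ContinuousLinearMap.differentiableAt _) hηs
  set A := connForm k V t f with hA
  have hAd : DifferentiableAt ℝ A x := (M.smooth_connForm hz' hf hpx).differentiableAt (by simp)
  have ht : DifferentiableAt ℝ t x := (M.smooth_t x hxO).differentiableAt (by simp)
  have hB1 : ∀ b, φ z ![W z, V z, b] + extDeriv η z ![V z, b] = 0 := fun b => by
    rw [M.extDeriv_potential_V hz, alt3_swap01, ← M.form_eq z hz, hW, M.hamiltonian _ hxO]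
    simp
  have hWH : W z = horLift k V t f x (U x) := by
    refine M.horizontal_ext hz hW0 ?_ ?_
    · have := M.metric_V_horLift hz' hpx (U x); rwa [hfz] at this
    · have := M.proj_horLift hz' hfd hpf (U x)
      rw [hfz] at this
      rw [this, hW]
  -- the pullback of `t θ` by the section `f` is `t A`, and `dA` is given by the curvature formula
  have hB2 : ∀ a b, φ z ![W z, fderiv ℝ f x a, fderiv ℝ f x b]
      + extDeriv η z ![fderiv ℝ f x a, fderiv ℝ f x b] = 0 := by
    intro a b
    have h1 := extDeriv_pullback hηd (hf.of_le (m := 2) ENat.LEInfty.out)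
      minSmoothness_of_isRCLikeNormedField.le
    have h2 : (fun y => (η (f y)).compContinuousLinearMap (fderiv ℝ f y)) =ᶠ[𝓝 x]
        fun y => oneForm F (t y • A y) := by
      filter_upwards [hpf] with y hy
      ext v
      change t (p (f y)) ^ 3 * k (f y) (V (f y)) (fderiv ℝ f y (v 0))
        = t y * (t y ^ 2 * k (f y) (V (f y)) (fderiv ℝ f y (v 0)))
      rw [hy]
      ring
    rw [h2.extDeriv_eq] at h1
    have h3 := DFunLike.congr_fun h1 ![a, b]
    rw [extDeriv_oneForm (A := fun y => t y • A y) (ht.smul hAd), fderiv_fun_smul ht hAd] at h3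
    have h4 : (⇑(fderiv ℝ f x) ∘ ![a, b] : Fin 2 → E) = ![fderiv ℝ f x a, fderiv ℝ f x b] := by
      ext i; fin_cases i <;> rfl
    rw [ContinuousAlternatingMap.compContinuousLinearMap_apply, h4, hfz] at h3
    rw [← h3]
    have h5 := M.curvature hz' hf hpf a b
    have e := fun a => push_eq_horLift_add (k := k) (V := V) (t := t) f x a
    have h6 := alt3_add_smul (φ z) (W z) (horLift k V t f x a) (horLift k V t f x b) (V z) 0
      (A x a) (A x b)
    have h7 : ∀ a, φ z ![V z, W z, horLift k V t f x a] = -fderiv ℝ t x a := fun a => by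
      have := M.proj_horLift hz' hfd hpf a
      rw [hfz] at this
      rw [← M.form_eq z hz, hW, this, M.hamiltonian _ hxO]
    have h0 : t x ≠ 0 := (M.t_pos hz).ne'
    rw [realForm_apply, ← hWH, hfz] at h5
    rw [h7, h7, zero_smul, add_zero, zero_mul] at h6
    rw [e a, e b, hfz, h6]
    simp only [_root_.add_apply, _root_.smul_apply, ContinuousLinearMap.smulRight_apply,
      smul_eq_mul]
    have h8 := mul_inv_cancel₀ h0
    linear_combination t x * h5 - φ z ![W z, horLift k V t f x a, horLift k V t f x b] * h8
  have hdec : ∀ a, ∃ c : ℝ, a = fderiv ℝ f x (fderiv ℝ p z a) + c • V z := fun a => by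
    have h1 := M.proj_section hz' hfd hpf (fderiv ℝ p z a)
    rw [hfz] at h1
    obtain ⟨c, hc⟩ := (M.ker z hz (a - fderiv ℝ f x (fderiv ℝ p z a))).1 (by
      rw [map_sub, h1, sub_self])
    exact ⟨c, by rw [← hc]; abel⟩
  ext v
  have hv : v = ![v 0, v 1] := by ext i; fin_cases i <;> rfl
  set B : E [⋀^Fin 2]→L[ℝ] ℝ := interiorProd W φ z + extDeriv η z with hB
  have hB1' : ∀ b, B ![V z, b] = 0 := hB1
  have hB2' : ∀ a b, B ![fderiv ℝ f x a, fderiv ℝ f x b] = 0 := hB2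
  have hB0 : B v = 0 := by
    obtain ⟨c, hc⟩ := hdec (v 0)
    obtain ⟨d, hd⟩ := hdec (v 1)
    rw [hv, hc, alt_cons_add, alt_cons_smul, hB1', hd, alt2_swap, alt_cons_add, alt_cons_smul,
      hB1', hB2']
    simp
  exact eq_neg_of_add_eq_zero_left hB0

variable (hW : ∀ z ∈ Ω, fderiv ℝ p z (W z) = U (p z)) (hW0 : ∀ z ∈ Ω, k z (V z) (W z) = 0)
include hW hW0

/-- The lift solves `L W = (U ∘ p, 0)` for the invertible linear maps `L = (dp, k(V, ·))`. -/
lemma smooth_lift (hz : z ∈ Ω) : ContDiffAt ℝ ∞ W z := by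
  have := M.finiteDimensional_base
  have := M.finiteDimensional_total hz
  have : CompleteSpace E := FiniteDimensional.complete ℝ E
  set L : E → E →L[ℝ] F × ℝ := fun z => (fderiv ℝ p z).prod (k z (V z)) with hL
  have hLi : ∀ z ∈ Ω, (L z).IsInvertible := by
    intro z hz
    have hinj : Function.Injective (L z) := by
      intro v w hvw
      have h1 : fderiv ℝ p z v = fderiv ℝ p z w := congrArg Prod.fst hvw
      have h2 : k z (V z) v = k z (V z) w := congrArg Prod.snd hvw
      obtain ⟨c, hc⟩ := (M.ker z hz (v - w)).1 (by rw [map_sub, h1, sub_self])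
      have h3 : k z (V z) (v - w) = 0 := by rw [map_sub, h2, sub_self]
      rw [hc, map_smul, smul_eq_mul, mul_eq_zero, or_iff_left (M.metric_V_pos hz).ne'] at h3
      rw [h3, zero_smul] at hc
      exact sub_eq_zero.1 hc
    have hsurj : Function.Surjective (L z) := by
      rintro ⟨a, s⟩
      obtain ⟨v, hv⟩ := M.surjective z hz a
      refine ⟨v + (t (p z) ^ 2 * (s - k z (V z) v)) • V z, Prod.ext ?_ ?_⟩
      · simp [hL, M.proj_V hz, hv]
      · change k z (V z) (v + (t (p z) ^ 2 * (s - k z (V z) v)) • V z) = s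
        rw [map_add, map_smul, smul_eq_mul]
        linear_combination (s - k z (V z) v) * M.t_sq_mul hz
    exact ⟨(LinearEquiv.ofBijective (L z : E →ₗ[ℝ] F × ℝ) ⟨hinj, hsurj⟩).toContinuousLinearEquiv,
      by ext v <;> rfl⟩
  have hLs : ContDiffAt ℝ ∞ L z := by
    have h1 : ContDiffAt ℝ ∞ (fun z => ContinuousLinearMap.inl ℝ F ℝ ∘L fderiv ℝ p z
        + ContinuousLinearMap.inr ℝ F ℝ ∘L k z (V z)) z :=
      (contDiffAt_const.clm_comp ((M.smooth_p z hz).fderiv_right (m := ∞) (by simp))).add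
        (contDiffAt_const.clm_comp ((M.smooth_metric z hz).clm_apply (M.smooth_V z hz)))
    refine h1.congr_of_eventuallyEq (Eventually.of_forall fun y => ?_)
    ext v <;> simp [hL]
  have h1 : ContDiffAt ℝ ∞ (fun y => (L y).inverse) z := by
    obtain ⟨e, he⟩ := hLi z hz
    have := contDiffAt_map_inverse (n := ∞) e
    rw [he] at this
    exact this.comp z hLs
  have h2 : ContDiffAt ℝ ∞ (fun y => (L y).inverse (U (p y), 0)) z :=
    h1.clm_apply (((M.smooth_U _ (M.mapsTo hz)).comp z (M.smooth_p z hz)).prodMk contDiffAt_const)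
  refine h2.congr_of_eventuallyEq ?_
  filter_upwards [M.eventually_mem hz] with y hy
  obtain ⟨e, he⟩ := hLi y hy
  have h3 : L y (W y) = (U (p y), 0) := Prod.ext (hW y hy) (hW0 y hy)
  rw [← h3, ← he, ContinuousLinearMap.inverse_equiv]
  simp

/-- `ι_W φ` is exact and `φ` is closed, so `L_W φ = 0` by Cartan's formula. -/
lemma lie_phi_lift (hz : z ∈ Ω) (v : Fin 3 → E) : flatLie W φ z v = 0 := by
  have hWs := M.smooth_lift hW hW0 hz
  rw [← extDeriv_interiorProd_add (hWs.differentiableAt (by simp))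
    ((M.smooth_phi z hz).differentiableAt (by simp)), M.closed_phi z hz]
  set η := fun y => oneForm E (potential k V p t y) with hη
  have h1 : interiorProd W φ =ᶠ[𝓝 z] fun y => -extDeriv η y := by
    filter_upwards [M.eventually_mem hz] with y hy using M.interior_phi_eq hy (hW y hy) (hW0 y hy)
  have hηs : ContDiffAt ℝ ∞ η z :=
    ContDiffAt.comp z (g := oneForm E) (ContinuousLinearMap.contDiff _).contDiffAt
      (M.smooth_potential hz)
  have h2 : extDeriv (fun y => -extDeriv η y) z = 0 := by
    have : extDeriv (fun y => -extDeriv η y) z = -extDeriv (extDeriv η) z := by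
      have := extDeriv_fun_smul (x := z) (-1 : ℝ) (extDeriv η)
      simp only [neg_smul, one_smul] at this
      exact this
    rw [this, extDeriv_extDeriv_apply (hηs.of_le (m := 2) ENat.LEInfty.out)
      minSmoothness_of_isRCLikeNormedField.le, neg_zero]
  rw [h1.extDeriv_eq, h2]
  simp

/-- The bracket `[W, V]` is vertical, as `W` projects to a field on the base and `V` to zero. It is
also horizontal: differentiate `k(V, W) = 0` along `V`, which preserves `k`. -/
lemma lieBracket_lift (hz : z ∈ Ω) : fderiv ℝ V z (W z) - fderiv ℝ W z (V z) = 0 := by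
  have hWd := ((M.smooth_lift hW hW0 hz).differentiableAt (by simp)).hasFDerivAt
  have hV := ((M.smooth_V z hz).differentiableAt (by simp)).hasFDerivAt
  have hk := ((M.smooth_metric z hz).differentiableAt (by simp)).hasFDerivAt
  have hp : HasFDerivAt (fderiv ℝ p) (fderiv ℝ (fderiv ℝ p) z) z :=
    (((M.smooth_p z hz).fderiv_right (m := ∞) (by simp)).differentiableAt (by simp)).hasFDerivAt
  have hsym : IsSymmSndFDerivAt ℝ p z :=
    (M.smooth_p z hz).isSymmSndFDerivAt (by
      rw [minSmoothness_of_isRCLikeNormedField]; exact ENat.LEInfty.out)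
  have hU : HasFDerivAt (fun y => U (p y)) (fderiv ℝ U (p z) ∘L fderiv ℝ p z) z :=
    ((M.smooth_U _ (M.mapsTo hz)).differentiableAt (by simp)).hasFDerivAt.comp z
      ((M.smooth_p z hz).differentiableAt (by simp)).hasFDerivAt
  have h1 := DFunLike.congr_fun ((hp.clm_apply hWd).unique (hU.congr_of_eventuallyEq (by
    filter_upwards [M.eventually_mem hz] with y hy using hW y hy))) (V z)
  have h2 := DFunLike.congr_fun ((hp.clm_apply hV).unique
    ((hasFDerivAt_const (0 : F) z).congr_of_eventuallyEq (by
      filter_upwards [M.eventually_mem hz] with y hy using M.proj_V hy))) (W z)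
  have h3 := DFunLike.congr_fun (((hk.clm_apply hV).clm_apply hWd).unique
    ((hasFDerivAt_const (0 : ℝ) z).congr_of_eventuallyEq (by
      filter_upwards [M.eventually_mem hz] with y hy using hW0 y hy))) (V z)
  have h4 := (M.lie_metric_chi hz (M.lie_phi z hz)).1 (V z) (W z)
  simp [M.proj_V hz] at h1 h2 h3
  have h5 := hsym (W z) (V z)
  refine M.horizontal_ext hz ?_ (map_zero _) ?_
  · rw [map_sub]
    linarith
  · rw [map_sub, map_zero]
    have e1 := eq_neg_of_add_eq_zero_left h1
    have e2 := eq_neg_of_add_eq_zero_left h2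
    rw [e1, e2, h5]
    abel

end LocalModel
end Lift

/-! ### Vector fields in charts -/

section Charts
open Filter Topology

variable {E : Type*} [NormedAddCommGroup E] [NormedSpace ℝ E]
  {M : Type*} [TopologicalSpace M] [ChartedSpace E M]

/-- The derivative of the inverse of the chart around `x₀`. -/
def chartDeriv (x₀ : M) (z : E) :
    E →L[ℝ] TangentSpace 𝓘(ℝ, E) ((extChartAt 𝓘(ℝ, E) x₀).symm z) :=
  mfderiv 𝓘(ℝ, E) 𝓘(ℝ, E) (extChartAt 𝓘(ℝ, E) x₀).symm z

/-- The expression of the vector field `X` in the chart around `x₀`. -/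
def VField.inChart (X : VField E M) (x₀ : M) : E → E :=
  VectorField.mpullback 𝓘(ℝ, E) 𝓘(ℝ, E) (extChartAt 𝓘(ℝ, E) x₀).symm X

lemma VField.inChart_apply (X : VField E M) (x₀ : M) (z : E) :
    X.inChart x₀ z = (chartDeriv x₀ z).inverse (X ((extChartAt 𝓘(ℝ, E) x₀).symm z)) := rfl

/-- The vector field which is constant, with value `v`, in the chart around `x₀`. -/
def constField (x₀ : M) (v : E) : VField E M :=
  VectorField.mpullback 𝓘(ℝ, E) 𝓘(ℝ, E) (extChartAt 𝓘(ℝ, E) x₀) fun _ => v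

variable {x₀ : M} {z : E}

lemma target_mem_nhds (hz : z ∈ (extChartAt 𝓘(ℝ, E) x₀).target) :
    (extChartAt 𝓘(ℝ, E) x₀).target ∈ 𝓝 z :=
  (isOpen_extChartAt_target x₀).mem_nhds hz

variable [IsManifold 𝓘(ℝ, E) ∞ M]

lemma contMDiffAt_chart_symm (hz : z ∈ (extChartAt 𝓘(ℝ, E) x₀).target) :
    ContMDiffAt 𝓘(ℝ, E) 𝓘(ℝ, E) ∞ (extChartAt 𝓘(ℝ, E) x₀).symm z :=
  (contMDiffOn_extChartAt_symm x₀).contMDiffAt (target_mem_nhds hz)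

lemma isInvertible_chartDeriv (hz : z ∈ (extChartAt 𝓘(ℝ, E) x₀).target) :
    (chartDeriv x₀ z).IsInvertible := by
  have := isInvertible_mfderivWithin_extChartAt_symm (I := 𝓘(ℝ, E)) hz
  rw [ModelWithCorners.range_eq_univ, mfderivWithin_univ] at this
  exact this

lemma chartDeriv_inChart (X : VField E M) (hz : z ∈ (extChartAt 𝓘(ℝ, E) x₀).target) :
    chartDeriv x₀ z (X.inChart x₀ z) = X ((extChartAt 𝓘(ℝ, E) x₀).symm z) := by
  obtain ⟨e, he⟩ := isInvertible_chartDeriv hz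
  rw [VField.inChart_apply, ← he, ContinuousLinearMap.inverse_equiv]
  exact e.apply_symm_apply _

lemma inChart_eq_iff (X : VField E M) (hz : z ∈ (extChartAt 𝓘(ℝ, E) x₀).target) (v : E) :
    X.inChart x₀ z = v ↔ X ((extChartAt 𝓘(ℝ, E) x₀).symm z) = chartDeriv x₀ z v := by
  rw [← chartDeriv_inChart X hz]
  exact (isInvertible_chartDeriv hz).injective.eq_iff.symm

lemma smooth_inChart [CompleteSpace E] {X : VField E M}
    (hz : z ∈ (extChartAt 𝓘(ℝ, E) x₀).target)
    (hX : X.SmoothAt ((extChartAt 𝓘(ℝ, E) x₀).symm z)) : ContDiffAt ℝ ∞ (X.inChart x₀) z := by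
  have h : ContMDiffAt 𝓘(ℝ, E) 𝓘(ℝ, E).tangent ∞
      (fun y => (⟨y, X.inChart x₀ y⟩ : TangentBundle 𝓘(ℝ, E) E)) z :=
    ContMDiffAt.mpullback_vectorField_preimage hX (contMDiffAt_chart_symm hz)
      (isInvertible_chartDeriv (E := E) hz) (by simp)
  exact contMDiffAt_vectorSpace_iff_contDiffAt.1 h

lemma mfderiv_chart_chartDeriv (hz : z ∈ (extChartAt 𝓘(ℝ, E) x₀).target) (v : E) :
    mfderiv 𝓘(ℝ, E) 𝓘(ℝ, E) (extChartAt 𝓘(ℝ, E) x₀) ((extChartAt 𝓘(ℝ, E) x₀).symm z)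
      (chartDeriv x₀ z v) = v := by
  have := mfderiv_extChartAt_comp_mfderivWithin_extChartAt_symm (I := 𝓘(ℝ, E)) hz
  rw [ModelWithCorners.range_eq_univ, mfderivWithin_univ] at this
  exact DFunLike.congr_fun this v

lemma inverse_mfderiv_chart (hz : z ∈ (extChartAt 𝓘(ℝ, E) x₀).target) (v : E) :
    (mfderiv 𝓘(ℝ, E) 𝓘(ℝ, E) (extChartAt 𝓘(ℝ, E) x₀)
      ((extChartAt 𝓘(ℝ, E) x₀).symm z)).inverse v = chartDeriv x₀ z v := by
  have h := isInvertible_mfderiv_extChartAt (I := 𝓘(ℝ, E)) ((extChartAt 𝓘(ℝ, E) x₀).map_target hz)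
  exact h.inverse_apply_eq.2 (mfderiv_chart_chartDeriv hz v).symm

lemma mpullback_chart_inChart (X : VField E M) {x : M}
    (hx : x ∈ (extChartAt 𝓘(ℝ, E) x₀).source) :
    VectorField.mpullback 𝓘(ℝ, E) 𝓘(ℝ, E) (extChartAt 𝓘(ℝ, E) x₀) (X.inChart x₀) x = X x := by
  obtain ⟨z, hz, rfl⟩ : ∃ z ∈ (extChartAt 𝓘(ℝ, E) x₀).target, (extChartAt 𝓘(ℝ, E) x₀).symm z = x :=
    ⟨_, (extChartAt 𝓘(ℝ, E) x₀).map_source hx, (extChartAt 𝓘(ℝ, E) x₀).left_inv hx⟩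
  have e := congrArg (X.inChart x₀) ((extChartAt 𝓘(ℝ, E) x₀).right_inv hz)
  exact (congrArg (fun w : E => (mfderiv 𝓘(ℝ, E) 𝓘(ℝ, E) (extChartAt 𝓘(ℝ, E) x₀)
    ((extChartAt 𝓘(ℝ, E) x₀).symm z)).inverse w) e).trans
      ((inverse_mfderiv_chart hz _).trans (chartDeriv_inChart X hz))

lemma smoothAt_mpullback_chart [CompleteSpace E] {X : E → E} {x : M}
    (hx : x ∈ (extChartAt 𝓘(ℝ, E) x₀).source)
    (hX : ContDiffAt ℝ ∞ X (extChartAt 𝓘(ℝ, E) x₀ x)) :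
    VField.SmoothAt (VectorField.mpullback 𝓘(ℝ, E) 𝓘(ℝ, E) (extChartAt 𝓘(ℝ, E) x₀) X) x :=
  ContMDiffAt.mpullback_vectorField_preimage
    ((contMDiffAt_vectorSpace_iff_contDiffAt (E := E) (V := X)).2 hX)
    (contMDiffAt_extChartAt' (n := ∞) (by rwa [extChartAt_source] at hx))
    (isInvertible_mfderiv_extChartAt hx) (by simp)

lemma smoothAt_of_inChart [CompleteSpace E] {X : VField E M} {x : M}
    (hx : x ∈ (extChartAt 𝓘(ℝ, E) x₀).source)
    (hX : ContDiffAt ℝ ∞ (X.inChart x₀) (extChartAt 𝓘(ℝ, E) x₀ x)) : X.SmoothAt x := by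
  refine (smoothAt_mpullback_chart hx hX).congr_of_eventuallyEq ?_
  filter_upwards [(isOpen_extChartAt_source x₀).mem_nhds hx] with y hy
  rw [mpullback_chart_inChart X hy]

lemma smoothAt_constField [CompleteSpace E] {x : M} (hx : x ∈ (extChartAt 𝓘(ℝ, E) x₀).source)
    (v : E) : (constField x₀ v).SmoothAt x :=
  smoothAt_mpullback_chart hx contDiffAt_const

lemma constField_inChart (hz : z ∈ (extChartAt 𝓘(ℝ, E) x₀).target) (v : E) :
    (constField x₀ v).inChart x₀ z = v := by
  rw [inChart_eq_iff _ hz]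
  exact inverse_mfderiv_chart hz v

lemma dirDeriv_chartDeriv {f : M → ℝ} (hz : z ∈ (extChartAt 𝓘(ℝ, E) x₀).target)
    (hf : MDifferentiableAt 𝓘(ℝ, E) 𝓘(ℝ, ℝ) f ((extChartAt 𝓘(ℝ, E) x₀).symm z)) (v : E) :
    dirDeriv f _ (chartDeriv x₀ z v)
      = fderiv ℝ (fun y => f ((extChartAt 𝓘(ℝ, E) x₀).symm y)) z v := by
  have h1 := mfderiv_comp z hf ((contMDiffAt_chart_symm hz).mdifferentiableAt (by simp))
  rw [mfderiv_eq_fderiv] at h1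
  exact (DFunLike.congr_fun h1 v).symm

lemma inChart_mlieBracket [CompleteSpace E] {X Y : VField E M}
    (hz : z ∈ (extChartAt 𝓘(ℝ, E) x₀).target)
    (hX : X.SmoothAt ((extChartAt 𝓘(ℝ, E) x₀).symm z))
    (hY : Y.SmoothAt ((extChartAt 𝓘(ℝ, E) x₀).symm z)) :
    VField.inChart (VectorField.mlieBracket 𝓘(ℝ, E) X Y) x₀ z
      = fderiv ℝ (Y.inChart x₀) z (X.inChart x₀ z)
        - fderiv ℝ (X.inChart x₀) z (Y.inChart x₀ z) := by
  have : IsManifold 𝓘(ℝ, E) (minSmoothness ℝ 2) M := IsManifold.of_le (n := ∞) (by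
    rw [minSmoothness_of_isRCLikeNormedField]; exact ENat.LEInfty.out)
  have h1 := VectorField.mpullback_mlieBracket (hX.mdifferentiableAt (by simp))
    (hY.mdifferentiableAt (by simp)) ((contMDiffAt_chart_symm hz).of_le (m := 2) ENat.LEInfty.out)
    minSmoothness_of_isRCLikeNormedField.le
  have h2 : ∀ A B : E → E, VectorField.mlieBracket 𝓘(ℝ, E) A B z
      = fderiv ℝ B z (A z) - fderiv ℝ A z (B z) := fun A B =>
    (congrFun VectorField.mlieBracketWithin_univ.symm z).trans
      ((congrFun VectorField.mlieBracketWithin_eq_lieBracketWithin z).trans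
        (congrFun (VectorField.lieBracketWithin_univ (𝕜 := ℝ) (V := A) (W := B)) z))
  exact h1.trans (h2 _ _)

end Charts

/-! ### Forms and metrics in charts -/

section ChartTensors
open Filter Topology

variable {E : Type*} [NormedAddCommGroup E] [NormedSpace ℝ E]
  {M : Type*} [TopologicalSpace M] [ChartedSpace E M] {x₀ : M} {z : E}

lemma DForm.inChart_apply {k : ℕ} (α : DForm E M k) (x₀ : M) (z : E) (v : Fin k → E) :
    α.inChart x₀ z v = α ((extChartAt 𝓘(ℝ, E) x₀).symm z) fun i => chartDeriv x₀ z (v i) := rfl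

lemma DForm.Smooth.contDiffAt {k : ℕ} {α : DForm E M k} (hα : α.Smooth)
    (hz : z ∈ (extChartAt 𝓘(ℝ, E) x₀).target) : ContDiffAt ℝ ∞ (α.inChart x₀) z :=
  (hα x₀).contDiffAt (target_mem_nhds hz)

variable [IsManifold 𝓘(ℝ, E) ∞ M]

lemma mdifferentiableAt_of_inChart {f : M → ℝ} (hz : z ∈ (extChartAt 𝓘(ℝ, E) x₀).target)
    (hf : DifferentiableAt ℝ (fun y => f ((extChartAt 𝓘(ℝ, E) x₀).symm y)) z) :
    MDifferentiableAt 𝓘(ℝ, E) 𝓘(ℝ, ℝ) f ((extChartAt 𝓘(ℝ, E) x₀).symm z) := by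
  have hx := (extChartAt 𝓘(ℝ, E) x₀).map_target hz
  have h1 : MDifferentiableAt 𝓘(ℝ, E) 𝓘(ℝ, E) (extChartAt 𝓘(ℝ, E) x₀)
      ((extChartAt 𝓘(ℝ, E) x₀).symm z) :=
    (contMDiffAt_extChartAt' (n := ∞) (by rwa [extChartAt_source] at hx)).mdifferentiableAt (by simp)
  have h2 : MDifferentiableAt 𝓘(ℝ, E) 𝓘(ℝ, ℝ) (fun y => f ((extChartAt 𝓘(ℝ, E) x₀).symm y))
      (extChartAt 𝓘(ℝ, E) x₀ ((extChartAt 𝓘(ℝ, E) x₀).symm z)) := by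
    rw [(extChartAt 𝓘(ℝ, E) x₀).right_inv hz]
    exact hf.mdifferentiableAt
  refine (h2.comp _ h1).congr_of_eventuallyEq ?_
  filter_upwards [(isOpen_extChartAt_source x₀).mem_nhds hx] with y hy
  simp only [Function.comp_apply, (extChartAt 𝓘(ℝ, E) x₀).left_inv hy]

/-- Directional derivatives in a chart. -/
lemma dirDeriv_eq_fderiv {f : M → ℝ} (hz : z ∈ (extChartAt 𝓘(ℝ, E) x₀).target)
    {f' : E → ℝ} (hff' : ∀ y ∈ (extChartAt 𝓘(ℝ, E) x₀).target,
      f ((extChartAt 𝓘(ℝ, E) x₀).symm y) = f' y) (hf : DifferentiableAt ℝ f' z) (v : E) :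
    dirDeriv f _ (chartDeriv x₀ z v) = fderiv ℝ f' z v := by
  have he : (fun y => f ((extChartAt 𝓘(ℝ, E) x₀).symm y)) =ᶠ[𝓝 z] f' := by
    filter_upwards [target_mem_nhds hz] with y hy using hff' y hy
  rw [dirDeriv_chartDeriv hz (mdifferentiableAt_of_inChart hz (hf.congr_of_eventuallyEq he)),
    he.fderiv_eq]

/-- The Lie derivative of a form in a chart. -/
lemma lieDerivative_eq_flatLie [CompleteSpace E] {k : ℕ} {α : DForm E M k} {X : VField E M}
    {Y : Fin k → VField E M} (hz : z ∈ (extChartAt 𝓘(ℝ, E) x₀).target)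
    (hα : DifferentiableAt ℝ (α.inChart x₀) z)
    (hX : X.SmoothAt ((extChartAt 𝓘(ℝ, E) x₀).symm z))
    (hY : ∀ i, (Y i).SmoothAt ((extChartAt 𝓘(ℝ, E) x₀).symm z)) :
    α.lieDerivative X Y ((extChartAt 𝓘(ℝ, E) x₀).symm z)
      = flatLie (X.inChart x₀) (α.inChart x₀) z fun i => (Y i).inChart x₀ z := by
  have hY' := fun i => (smooth_inChart hz (hY i)).differentiableAt (by simp)
  have h1 := hα.hasFDerivAt.continuousAlternatingMap_apply
    (fun i => (hY' i).hasFDerivAt)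
  have h2 := dirDeriv_eq_fderiv (f := fun x => α x fun i => Y i x) hz (fun y hy => by
    simp only [← chartDeriv_inChart (Y _) hy]; rfl) h1.differentiableAt (X.inChart x₀ z)
  rw [chartDeriv_inChart X hz] at h2
  rw [DForm.lieDerivative, h2, h1.fderiv]
  simp only [flatLie, _root_.add_apply, _root_.sum_apply]
  rw [add_sub_assoc, ← Finset.sum_sub_distrib]
  refine congrArg₂ (· + ·) rfl (Finset.sum_congr rfl fun i _ => ?_)
  have h3 : (Function.update (fun j => Y j ((extChartAt 𝓘(ℝ, E) x₀).symm z)) i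
      (VectorField.mlieBracket 𝓘(ℝ, E) X (Y i) ((extChartAt 𝓘(ℝ, E) x₀).symm z)))
      = fun j => chartDeriv x₀ z (Function.update (fun x => (Y x).inChart x₀ z) i
        (VField.inChart (VectorField.mlieBracket 𝓘(ℝ, E) X (Y i)) x₀ z) j) := by
    funext j
    rcases eq_or_ne j i with rfl | hj
    · simp only [Function.update_self]
      exact (chartDeriv_inChart _ hz).symm
    · simp only [Function.update_of_ne hj]
      exact (chartDeriv_inChart _ hz).symm
  rw [h3, ← DForm.inChart_apply, inChart_mlieBracket hz hX (hY i),
    ContinuousAlternatingMap.map_update_sub]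
  exact sub_sub_cancel _ _

lemma DForm.IsPreservedBy.flatLie_eq_zero [CompleteSpace E] {k : ℕ} {α : DForm E M k}
    {X : VField E M} (h : α.IsPreservedBy X) (hα : α.Smooth) (hX : X.Smooth)
    (hz : z ∈ (extChartAt 𝓘(ℝ, E) x₀).target) (v : Fin k → E) :
    flatLie (X.inChart x₀) (α.inChart x₀) z v = 0 := by
  have hs : ∀ i, (constField x₀ (v i)).SmoothAt ((extChartAt 𝓘(ℝ, E) x₀).symm z) := fun i =>
    smoothAt_constField ((extChartAt 𝓘(ℝ, E) x₀).map_target hz) (v i)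
  have h1 := lieDerivative_eq_flatLie (Y := fun i => constField x₀ (v i)) hz
    ((hα.contDiffAt hz).differentiableAt (by simp)) (hX _) hs
  rw [h _ _ hs] at h1
  simp only [constField_inChart hz] at h1
  exact h1.symm

lemma isPreservedBy_of_inChart [CompleteSpace E] {k : ℕ} {α : DForm E M k} {X : VField E M}
    (hα : α.Smooth) (hX : X.Smooth)
    (h : ∀ x : M, ∃ x₀, ∃ z ∈ (extChartAt 𝓘(ℝ, E) x₀).target,
      (extChartAt 𝓘(ℝ, E) x₀).symm z = x ∧
        ∀ v, flatLie (X.inChart x₀) (α.inChart x₀) z v = 0) : α.IsPreservedBy X := by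
  intro x Y hY
  obtain ⟨x₀, z, hz, rfl, h0⟩ := h x
  rw [lieDerivative_eq_flatLie hz ((hα.contDiffAt hz).differentiableAt (by simp)) (hX _) hY, h0]

/-- The expression in a chart of a Riemannian metric. -/
def RMetric.inChart (g : RMetric E M) (x₀ : M) (z : E) : E →L[ℝ] E →L[ℝ] ℝ :=
  ContinuousLinearMap.precomp ℝ (chartDeriv x₀ z) ∘L
    Bundle.ContMDiffRiemannianMetric.inner g ((extChartAt 𝓘(ℝ, E) x₀).symm z) ∘L chartDeriv x₀ z

lemma RMetric.inChart_apply (g : RMetric E M) (x₀ : M) (z a b : E) :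
    g.inChart x₀ z a b
      = g.ip ((extChartAt 𝓘(ℝ, E) x₀).symm z) (chartDeriv x₀ z a) (chartDeriv x₀ z b) := rfl

lemma RMetric.contMDiffAt_ip (g : RMetric E M) {X Y : VField E M} {x : M} (hX : X.SmoothAt x)
    (hY : Y.SmoothAt x) : ContMDiffAt 𝓘(ℝ, E) 𝓘(ℝ, ℝ) ∞ (fun y => g.ip y (X y) (Y y)) x := by
  have : ContMDiffAt 𝓘(ℝ, E) (𝓘(ℝ, E).prod 𝓘(ℝ)) ∞
      (fun m ↦ Bundle.TotalSpace.mk' ℝ (E := Bundle.Trivial M ℝ) m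
        (Bundle.ContMDiffRiemannianMetric.inner g m (X m) (Y m))) x := by
    apply ContMDiffAt.clm_bundle_apply₂ (F₁ := E) (F₂ := E)
    · exact g.contMDiff.contMDiffAt
    · exact hX
    · exact hY
  simp only [Bundle.contMDiffAt_totalSpace] at this
  exact this.2

lemma RMetric.contDiffAt_inChart [FiniteDimensional ℝ E] (g : RMetric E M)
    (hz : z ∈ (extChartAt 𝓘(ℝ, E) x₀).target) : ContDiffAt ℝ ∞ (g.inChart x₀) z := by
  have : CompleteSpace E := FiniteDimensional.complete ℝ E
  have h : ContDiffOn ℝ ∞ (g.inChart x₀) (extChartAt 𝓘(ℝ, E) x₀).target := by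
    refine contDiffOn_clm_apply.2 fun a => contDiffOn_clm_apply.2 fun b y hy => ?_
    have hs : ∀ a, (constField x₀ a).SmoothAt ((extChartAt 𝓘(ℝ, E) x₀).symm y) := fun a =>
      smoothAt_constField ((extChartAt 𝓘(ℝ, E) x₀).map_target hy) a
    have h1 := ((g.contMDiffAt_ip (hs a) (hs b)).comp y (contMDiffAt_chart_symm hy)).contDiffAt
    refine (h1.congr_of_eventuallyEq ?_).contDiffWithinAt
    filter_upwards [target_mem_nhds hy] with w hw
    have := fun a => (inChart_eq_iff _ hw _).1 (constField_inChart hw a)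
    simp only [Function.comp_apply, this]
    rfl
  exact h.contDiffAt (target_mem_nhds hz)

lemma isKilling_of_inChart [FiniteDimensional ℝ E] (g : RMetric E M) {X : VField E M}
    (hX : X.Smooth) (h : ∀ x : M, ∃ x₀, ∃ z ∈ (extChartAt 𝓘(ℝ, E) x₀).target,
      (extChartAt 𝓘(ℝ, E) x₀).symm z = x ∧ ∀ a b,
      fderiv ℝ (g.inChart x₀) z (X.inChart x₀ z) a b
        + g.inChart x₀ z (fderiv ℝ (X.inChart x₀) z a) b
        + g.inChart x₀ z a (fderiv ℝ (X.inChart x₀) z b) = 0) : g.IsKilling X := by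
  have : CompleteSpace E := FiniteDimensional.complete ℝ E
  intro x Y Z hY hZ
  obtain ⟨x₀, z, hz, rfl, h0⟩ := h x
  have hY' := ((smooth_inChart hz hY).differentiableAt (by simp)).hasFDerivAt
  have hZ' := ((smooth_inChart hz hZ).differentiableAt (by simp)).hasFDerivAt
  have hg := ((g.contDiffAt_inChart hz).differentiableAt (by simp)).hasFDerivAt
  have h1 := (hg.clm_apply hY').clm_apply hZ'
  have h2 := dirDeriv_eq_fderiv (f := fun x => g.ip x (Y x) (Z x)) hz (fun y hy => by
    rw [← chartDeriv_inChart Y hy, ← chartDeriv_inChart Z hy]; rfl)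
    h1.differentiableAt (X.inChart x₀ z)
  rw [chartDeriv_inChart X hz, h1.fderiv] at h2
  rw [h2, ← chartDeriv_inChart (VectorField.mlieBracket 𝓘(ℝ, E) X Y) hz,
    ← chartDeriv_inChart (VectorField.mlieBracket 𝓘(ℝ, E) X Z) hz, ← chartDeriv_inChart Y hz,
    ← chartDeriv_inChart Z hz, ← RMetric.inChart_apply, ← RMetric.inChart_apply,
    inChart_mlieBracket hz (hX _) hY, inChart_mlieBracket hz (hX _) hZ]
  have h3 := h0 (Y.inChart x₀ z) (Z.inChart x₀ z)
  simp only [map_sub, _root_.sub_apply, _root_.add_apply, ContinuousLinearMap.comp_apply,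
    ContinuousLinearMap.flip_apply]
  linarith

end ChartTensors

/-! ### Endomorphism fields and maps in charts -/

section ChartEndo
open Filter Topology

variable {E : Type*} [NormedAddCommGroup E] [NormedSpace ℝ E]
  {M : Type*} [TopologicalSpace M] [ChartedSpace E M] {x₀ : M} {z : E}

/-- The expression in a chart of a field of endomorphisms. -/
def EndoField.inChart (J : EndoField E M) (x₀ : M) (z : E) : E →L[ℝ] E :=
  (chartDeriv x₀ z).inverse ∘L J ((extChartAt 𝓘(ℝ, E) x₀).symm z) ∘L chartDeriv x₀ z

/-- Applying a field of endomorphisms to a vector field. -/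
def EndoField.app (J : EndoField E M) (X : VField E M) : VField E M := fun x => J x (X x)

variable [IsManifold 𝓘(ℝ, E) ∞ M]

lemma chartDeriv_endo_inChart (J : EndoField E M) (hz : z ∈ (extChartAt 𝓘(ℝ, E) x₀).target)
    (a : E) : chartDeriv x₀ z (J.inChart x₀ z a)
      = J ((extChartAt 𝓘(ℝ, E) x₀).symm z) (chartDeriv x₀ z a) := by
  obtain ⟨e, he⟩ := isInvertible_chartDeriv hz
  simp only [EndoField.inChart, ContinuousLinearMap.comp_apply]
  rw [← he, ContinuousLinearMap.inverse_equiv]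
  exact e.apply_symm_apply _

lemma app_inChart (J : EndoField E M) (X : VField E M)
    (hz : z ∈ (extChartAt 𝓘(ℝ, E) x₀).target) :
    (J.app X).inChart x₀ z = J.inChart x₀ z (X.inChart x₀ z) := by
  rw [inChart_eq_iff _ hz, chartDeriv_endo_inChart J hz, chartDeriv_inChart X hz]
  rfl

lemma EndoField.Smooth.smoothAt_app {J : EndoField E M} (hJ : J.Smooth) {X : VField E M} {x : M}
    (hX : X.SmoothAt x) : (J.app X).SmoothAt x :=
  ContMDiffAt.clm_bundle_apply (F₁ := E) (F₂ := E) (b := fun m : M => m) hJ.contMDiffAt hX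

lemma EndoField.Smooth.contDiffAt_inChart [FiniteDimensional ℝ E] {J : EndoField E M}
    (hJ : J.Smooth) (hz : z ∈ (extChartAt 𝓘(ℝ, E) x₀).target) :
    ContDiffAt ℝ ∞ (J.inChart x₀) z := by
  have : CompleteSpace E := FiniteDimensional.complete ℝ E
  have h : ContDiffOn ℝ ∞ (J.inChart x₀) (extChartAt 𝓘(ℝ, E) x₀).target := by
    refine contDiffOn_clm_apply.2 fun a y hy => ?_
    have h1 := smooth_inChart hy (hJ.smoothAt_app
      (smoothAt_constField ((extChartAt 𝓘(ℝ, E) x₀).map_target hy) a))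
    refine (h1.congr_of_eventuallyEq ?_).contDiffWithinAt
    filter_upwards [target_mem_nhds hy] with w hw
    rw [app_inChart J _ hw, constField_inChart hw]
  exact h.contDiffAt (target_mem_nhds hz)

/-- The Nijenhuis tensor in a chart, evaluated on constant vector fields. -/
lemma nijenhuis_inChart [FiniteDimensional ℝ E] {J : EndoField E M} (hJ : J.Smooth)
    (hN : J.NijenhuisZero) (hz : z ∈ (extChartAt 𝓘(ℝ, E) x₀).target) (a b : E) :
    fderiv ℝ (J.inChart x₀) z (J.inChart x₀ z a) b - fderiv ℝ (J.inChart x₀) z (J.inChart x₀ z b) a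
      + J.inChart x₀ z (fderiv ℝ (J.inChart x₀) z b a)
      - J.inChart x₀ z (fderiv ℝ (J.inChart x₀) z a b) = 0 := by
  have : CompleteSpace E := FiniteDimensional.complete ℝ E
  have hs := fun a => smoothAt_constField ((extChartAt 𝓘(ℝ, E) x₀).map_target hz) a
  have hJs := fun a => hJ.smoothAt_app (hs a)
  have hJd := ((hJ.contDiffAt_inChart hz).differentiableAt (by simp)).hasFDerivAt
  have hc : ∀ a, (constField x₀ a).inChart x₀ =ᶠ[𝓝 z] fun _ => a := fun a => by
    filter_upwards [target_mem_nhds hz] with w hw using constField_inChart hw a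
  have hJc : ∀ a, (J.app (constField x₀ a)).inChart x₀ =ᶠ[𝓝 z] fun w => J.inChart x₀ w a :=
    fun a => by
      filter_upwards [target_mem_nhds hz] with w hw
      rw [app_inChart J _ hw, constField_inChart hw]
  have d1 : ∀ a u, fderiv ℝ ((constField x₀ a).inChart x₀) z u = 0 := fun a u => by
    rw [(hc a).fderiv_eq]; simp
  have d2 : ∀ a u, fderiv ℝ ((J.app (constField x₀ a)).inChart x₀) z u
      = fderiv ℝ (J.inChart x₀) z u a := fun a u => by
    rw [(hJc a).fderiv_eq, (hJd.clm_apply (hasFDerivAt_const a z)).fderiv]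
    simp
  have h := hN _ _ _ (hs a) (hs b)
  have h' : chartDeriv x₀ z (VField.inChart (VectorField.mlieBracket 𝓘(ℝ, E)
        (J.app (constField x₀ a)) (J.app (constField x₀ b))) x₀ z
      - J.inChart x₀ z (VField.inChart (VectorField.mlieBracket 𝓘(ℝ, E)
        (J.app (constField x₀ a)) (constField x₀ b)) x₀ z)
      - J.inChart x₀ z (VField.inChart (VectorField.mlieBracket 𝓘(ℝ, E)
        (constField x₀ a) (J.app (constField x₀ b))) x₀ z)
      - VField.inChart (VectorField.mlieBracket 𝓘(ℝ, E)
        (constField x₀ a) (constField x₀ b)) x₀ z) = 0 := by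
    rw [map_sub, map_sub, map_sub, chartDeriv_endo_inChart J hz, chartDeriv_endo_inChart J hz]
    simp only [chartDeriv_inChart _ hz]
    exact h
  rw [inChart_mlieBracket hz (hJs a) (hJs b), inChart_mlieBracket hz (hJs a) (hs b),
    inChart_mlieBracket hz (hs a) (hJs b), inChart_mlieBracket hz (hs a) (hs b)] at h'
  simp only [d1, d2, (hc _).self_of_nhds, (hJc _).self_of_nhds, zero_sub, sub_zero, map_neg,
    sub_neg_eq_add] at h'
  obtain ⟨e, he⟩ := isInvertible_chartDeriv hz
  rw [← he] at h'
  exact e.map_eq_zero_iff.1 h'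

end ChartEndo

section Projection
open Filter Topology

variable {E : Type*} [NormedAddCommGroup E] [NormedSpace ℝ E]
  {M : Type*} [TopologicalSpace M] [ChartedSpace E M]
  {F : Type*} [NormedAddCommGroup F] [NormedSpace ℝ F]
  {N : Type*} [TopologicalSpace N] [ChartedSpace F N]

/-- The expression in charts of a map between manifolds. -/
def mapInChart (p : M → N) (x₀ : M) (n₀ : N) (z : E) : F :=
  extChartAt 𝓘(ℝ, F) n₀ (p ((extChartAt 𝓘(ℝ, E) x₀).symm z))

/-- The set where the expression of a map in charts is meaningful. -/
def chartDomain (p : M → N) (x₀ : M) (n₀ : N) : Set E :=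
  (extChartAt 𝓘(ℝ, E) x₀).target ∩
    (fun z => p ((extChartAt 𝓘(ℝ, E) x₀).symm z)) ⁻¹' (extChartAt 𝓘(ℝ, F) n₀).source

variable {p : M → N} {x₀ : M} {n₀ : N} {z : E}

lemma isOpen_chartDomain (hp : Continuous p) : IsOpen (chartDomain (E := E) (F := F) p x₀ n₀) :=
  (hp.comp_continuousOn (continuousOn_extChartAt_symm x₀)).isOpen_inter_preimage
    (isOpen_extChartAt_target x₀) (isOpen_extChartAt_source n₀)

lemma mapInChart_mem (hz : z ∈ chartDomain (F := F) p x₀ n₀) :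
    mapInChart (F := F) p x₀ n₀ z ∈ (extChartAt 𝓘(ℝ, F) n₀).target :=
  (extChartAt 𝓘(ℝ, F) n₀).map_source hz.2

lemma symm_mapInChart (hz : z ∈ chartDomain (F := F) p x₀ n₀) :
    (extChartAt 𝓘(ℝ, F) n₀).symm (mapInChart (F := F) p x₀ n₀ z)
      = p ((extChartAt 𝓘(ℝ, E) x₀).symm z) :=
  (extChartAt 𝓘(ℝ, F) n₀).left_inv hz.2

variable [IsManifold 𝓘(ℝ, E) ∞ M] [IsManifold 𝓘(ℝ, F) ∞ N]

lemma contDiffAt_mapInChart (hp : ContMDiff 𝓘(ℝ, E) 𝓘(ℝ, F) ∞ p)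
    (hz : z ∈ chartDomain (F := F) p x₀ n₀) :
    ContDiffAt ℝ ∞ (mapInChart (F := F) p x₀ n₀) z := by
  have h1 : ContMDiffAt 𝓘(ℝ, F) 𝓘(ℝ, F) ∞ (extChartAt 𝓘(ℝ, F) n₀)
      (p ((extChartAt 𝓘(ℝ, E) x₀).symm z)) :=
    contMDiffAt_extChartAt' (by have := hz.2; rwa [Set.mem_preimage, extChartAt_source] at this)
  exact (h1.comp z ((hp _).comp z (contMDiffAt_chart_symm hz.1))).contDiffAt

lemma chartDeriv_mapInChart (hp : ContMDiff 𝓘(ℝ, E) 𝓘(ℝ, F) ∞ p)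
    (hz : z ∈ chartDomain (F := F) p x₀ n₀) (v : E) :
    (chartDeriv n₀ (mapInChart (F := F) p x₀ n₀ z) (fderiv ℝ (mapInChart p x₀ n₀) z v) : F)
      = mfderiv 𝓘(ℝ, E) 𝓘(ℝ, F) p ((extChartAt 𝓘(ℝ, E) x₀).symm z) (chartDeriv x₀ z v) := by
  have h1 := ((contDiffAt_mapInChart hp hz).differentiableAt (by simp)).mdifferentiableAt
  have h2 := (contMDiffAt_chart_symm (mapInChart_mem hz)).mdifferentiableAt (by simp)
  have h3 := mfderiv_comp z h2 h1
  have h4 := mfderiv_comp z ((hp ((extChartAt 𝓘(ℝ, E) x₀).symm z)).mdifferentiableAt (by simp))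
    ((contMDiffAt_chart_symm hz.1).mdifferentiableAt (by simp))
  have h5 : (extChartAt 𝓘(ℝ, F) n₀).symm ∘ mapInChart (F := F) p x₀ n₀
      =ᶠ[𝓝 z] p ∘ (extChartAt 𝓘(ℝ, E) x₀).symm := by
    filter_upwards [(isOpen_chartDomain hp.continuous).mem_nhds hz] with y hy
      using symm_mapInChart hy
  have h6 := h5.mfderiv_eq (I := 𝓘(ℝ, E)) (I' := 𝓘(ℝ, F))
  rw [mfderiv_eq_fderiv] at h3
  have e1 := DFunLike.congr_fun h3 v
  have e2 := DFunLike.congr_fun h4 v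
  have e3 := DFunLike.congr_fun h6 v
  exact (e1.symm.trans e3).trans e2

end Projection

/-! ### The quotient in charts -/

section Transport

variable {E : Type*} [NormedAddCommGroup E] [NormedSpace ℝ E]
  {M : Type*} [TopologicalSpace M] [ChartedSpace E M]

lemma VField.congr_point (X : VField E M) {x y : M} (h : x = y) : (X x : E) = X y := by
  subst h; rfl

lemma DForm.congr_point (α : DForm E M 2) {x y : M} (h : x = y) {a a' b b' : E} (ha : a = a')
    (hb : b = b') : (α x : E [⋀^Fin 2]→L[ℝ] ℝ) ![a, b] = (α y : E [⋀^Fin 2]→L[ℝ] ℝ) ![a', b'] := by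
  subst h ha hb; rfl

lemma DForm.inChart_two (α : DForm E M 2) (x₀ : M) (z a b : E) :
    α.inChart x₀ z ![a, b]
      = α ((extChartAt 𝓘(ℝ, E) x₀).symm z) ![chartDeriv x₀ z a, chartDeriv x₀ z b] := by
  rw [DForm.inChart_apply]
  congr 1
  ext i; fin_cases i <;> rfl

lemma DForm.inChart_three (α : DForm E M 3) (x₀ : M) (z a b c : E) :
    α.inChart x₀ z ![a, b, c] = α ((extChartAt 𝓘(ℝ, E) x₀).symm z)
      ![chartDeriv x₀ z a, chartDeriv x₀ z b, chartDeriv x₀ z c] := by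
  rw [DForm.inChart_apply]
  congr 1
  ext i; fin_cases i <;> rfl

lemma RMetric.congr_point [IsManifold 𝓘(ℝ, E) ∞ M] (g : RMetric E M) {x y : M} (h : x = y)
    {a a' b b' : E} (ha : a = a') (hb : b = b') : g.ip x a b = g.ip y a' b' := by
  subst h ha hb; rfl

end Transport

section Final
open Filter Topology

variable {Y : Type*} [TopologicalSpace Y] [ChartedSpace (Euc 7) Y] [IsManifold 𝓘(ℝ, Euc 7) ∞ Y]
    {N : Type*} [TopologicalSpace N] [ChartedSpace (Euc 6) N] [IsManifold 𝓘(ℝ, Euc 6) ∞ N]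
    {G : G2Structure Y} {V : VField (Euc 7) Y} {p : Y → N}
    {t : N → ℝ} {h : RMetric (Euc 6) N} {J : EndoField (Euc 6) N} {σ : DForm (Euc 6) N 2}
    {U : VField (Euc 6) N}

lemma IsQuotientBy.chartDeriv_proj (hp : IsQuotientBy p V) {y₀ : Y} {z : Euc 7}
    (hz : z ∈ chartDomain (F := Euc 6) p y₀ (p y₀)) (v : Euc 7) :
    (chartDeriv (p y₀) (mapInChart (F := Euc 6) p y₀ (p y₀) z)
      (fderiv ℝ (mapInChart p y₀ (p y₀)) z v) : Euc 6)
      = projDeriv p ((extChartAt 𝓘(ℝ, Euc 7) y₀).symm z) (chartDeriv y₀ z v) :=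
  chartDeriv_mapInChart hp.smooth hz v

lemma G2Structure.isG2Triple_inChart (G : G2Structure Y) {y₀ : Y} {z : Euc 7}
    (hz : z ∈ (extChartAt 𝓘(ℝ, Euc 7) y₀).target) :
    IsG2Triple (G.phi.inChart y₀ z) (G.metric.inChart y₀ z) (G.starPhi.inChart y₀ z) := by
  obtain ⟨e, h1, h2, h3⟩ := G.adapted ((extChartAt 𝓘(ℝ, Euc 7) y₀).symm z)
  obtain ⟨D, hD⟩ := isInvertible_chartDeriv hz
  refine ⟨D.trans e, fun v => ?_, fun v w => ?_, fun v => ?_⟩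
  · rw [DForm.inChart_apply, h1, ← hD]; rfl
  · rw [RMetric.inChart_apply, h2, ← hD]; rfl
  · rw [DForm.inChart_apply, h3, ← hD]; rfl

lemma IsQuotientBy.ker_inChart (hp : IsQuotientBy p V) {y₀ : Y} {z : Euc 7}
    (hz : z ∈ chartDomain (F := Euc 6) p y₀ (p y₀)) (v : Euc 7) :
    fderiv ℝ (mapInChart (F := Euc 6) p y₀ (p y₀)) z v = 0
      ↔ ∃ c : ℝ, v = c • V.inChart y₀ z := by
  have h1 := hp.kernel ((extChartAt 𝓘(ℝ, Euc 7) y₀).symm z) (chartDeriv y₀ z v)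
  have h2 := hp.chartDeriv_proj hz v
  have hi := (isInvertible_chartDeriv hz.1).injective
  have hj := (isInvertible_chartDeriv (mapInChart_mem hz)).injective
  constructor
  · intro h
    rw [h] at h2
    obtain ⟨c, hc⟩ := h1.1 (h2.symm.trans (map_zero _))
    refine ⟨c, hi ?_⟩
    rw [hc, map_smul, chartDeriv_inChart V hz.1]
  · rintro ⟨c, hc⟩
    have h3 : chartDeriv y₀ z v = c • V ((extChartAt 𝓘(ℝ, Euc 7) y₀).symm z) := by
      rw [hc, map_smul, chartDeriv_inChart V hz.1]
    exact hj ((h2.trans (h1.2 ⟨c, h3⟩)).trans (map_zero _).symm)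

lemma IsQuotientBy.surjective_inChart (hp : IsQuotientBy p V) {y₀ : Y} {z : Euc 7}
    (hz : z ∈ chartDomain (F := Euc 6) p y₀ (p y₀)) :
    Function.Surjective (fderiv ℝ (mapInChart (F := Euc 6) p y₀ (p y₀)) z) := by
  intro a
  have hj := (isInvertible_chartDeriv (mapInChart_mem hz)).injective
  obtain ⟨D, hD⟩ := isInvertible_chartDeriv hz.1
  obtain ⟨w, hw⟩ := hp.submersion ((extChartAt 𝓘(ℝ, Euc 7) y₀).symm z)
    (chartDeriv (p y₀) (mapInChart (F := Euc 6) p y₀ (p y₀) z) a : Euc 6)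
  refine ⟨D.symm w, hj ?_⟩
  have h1 : chartDeriv y₀ z (D.symm w) = w := by rw [← hD]; exact D.apply_symm_apply w
  have h2 := hp.chartDeriv_proj hz (D.symm w)
  rw [h1] at h2
  exact h2.trans hw

/-- In charts, the quotient of a torsion-free `G₂` structure is a local model. -/
lemma localModel_inChart (hG : G.TorsionFree) (hV : V.Smooth)
    (hVG : G.IsInfinitesimalAutomorphism V) (hp : IsQuotientBy p V)
    (hind : IsInducedOnQuotient G V p t h σ) (hK : IsKaehler h J σ) (hU : U.Smooth)
    (hUt : IsHamiltonianField σ (fun n => -t n) U) (y₀ : Y) :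
    LocalModel (chartDomain (F := Euc 6) p y₀ (p y₀)) (extChartAt 𝓘(ℝ, Euc 6) (p y₀)).target
      (G.phi.inChart y₀) (G.metric.inChart y₀) (G.starPhi.inChart y₀) (V.inChart y₀)
      (mapInChart p y₀ (p y₀)) (fun x => t ((extChartAt 𝓘(ℝ, Euc 6) (p y₀)).symm x))
      (h.inChart (p y₀)) (J.inChart (p y₀)) (σ.inChart (p y₀)) (U.inChart (p y₀)) := by
  have ht : ∀ x ∈ (extChartAt 𝓘(ℝ, Euc 6) (p y₀)).target,
      ContDiffAt ℝ ∞ (fun x => t ((extChartAt 𝓘(ℝ, Euc 6) (p y₀)).symm x)) x := fun x hx =>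
    ((hind.smooth_t _).comp x (contMDiffAt_chart_symm hx)).contDiffAt
  exact
  { finrank_eq := by simp
    isOpen_total := isOpen_chartDomain hp.smooth.continuous
    isOpen_base := isOpen_extChartAt_target _
    mapsTo := fun z hz => mapInChart_mem hz
    smooth_phi := fun z hz => G.smooth_phi.contDiffAt hz.1
    smooth_chi := fun z hz => G.smooth_starPhi.contDiffAt hz.1
    smooth_metric := fun z hz => G.metric.contDiffAt_inChart hz.1
    smooth_V := fun z hz => smooth_inChart hz.1 (hV _)
    smooth_p := fun z hz => contDiffAt_mapInChart hp.smooth hz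
    closed_phi := fun z hz => hG.1 y₀ z hz.1
    closed_chi := fun z hz => hG.2 y₀ z hz.1
    triple := fun z hz => G.isG2Triple_inChart hz.1
    lie_phi := fun z hz v => hVG.flatLie_eq_zero G.smooth_phi hV hz.1 v
    V_ne_zero := fun z hz h0 => hp.ne_zero _
      (((inChart_eq_iff V hz.1 0).1 h0).trans (map_zero _))
    surjective := fun z hz => hp.surjective_inChart hz
    ker := fun z hz v => hp.ker_inChart hz v
    smooth_t := ht
    t_eq := fun z hz => by
      rw [symm_mapInChart hz, hind.t_eq, RMetric.inChart_apply, chartDeriv_inChart V hz.1]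
    metric_eq := fun z hz v w hv hw => by
      rw [RMetric.inChart_apply, chartDeriv_inChart V hz.1] at hv hw
      rw [symm_mapInChart hz, RMetric.inChart_apply, hind.metric_eq _ _ _ hv hw,
        RMetric.inChart_apply]
      exact congrArg _ (h.congr_point (symm_mapInChart hz).symm (hp.chartDeriv_proj hz v).symm
        (hp.chartDeriv_proj hz w).symm)
    form_eq := fun z hz v w => by
      have h1 := hind.form_eq ((extChartAt 𝓘(ℝ, Euc 7) y₀).symm z) (chartDeriv y₀ z v)
        (chartDeriv y₀ z w)
      rw [← chartDeriv_inChart V hz.1] at h1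
      have h2 := σ.congr_point (symm_mapInChart hz) (hp.chartDeriv_proj hz v)
        (hp.chartDeriv_proj hz w)
      rw [DForm.inChart_two, DForm.inChart_three]
      exact h2.trans h1
    h_symm := fun x hx a b => h.symm _ _ _
    h_pos := fun x hx a ha => h.pos _ _ fun h0 => ha
      ((isInvertible_chartDeriv hx).injective (h0.trans (map_zero _).symm))
    J_sq := fun x hx a => (isInvertible_chartDeriv hx).injective (by
      rw [chartDeriv_endo_inChart J hx, chartDeriv_endo_inChart J hx, hK.sq, map_neg])
    J_orthogonal := fun x hx a b => by
      rw [RMetric.inChart_apply, chartDeriv_endo_inChart J hx, chartDeriv_endo_inChart J hx,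
        hK.orthogonal]
      rfl
    sigma_eq := fun x hx a b => by
      rw [RMetric.inChart_apply, chartDeriv_endo_inChart J hx, ← hK.form_eq, DForm.inChart_two]
    differentiable_J := fun x hx => (hK.smooth_J.contDiffAt_inChart hx).differentiableAt (by simp)
    smooth_sigma := fun x hx => hK.smooth_form.contDiffAt hx
    closed_sigma := fun x hx => hK.closed _ x hx
    nijenhuis := fun x hx a b => nijenhuis_inChart hK.smooth_J hK.integrable hx a b
    smooth_U := fun x hx => smooth_inChart hx (hU _)
    hamiltonian := fun x hx a => by
      have h1 := hUt _ (chartDeriv (p y₀) x a)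
      rw [dirDeriv_eq_fderiv hx (f' := fun x => -t ((extChartAt 𝓘(ℝ, Euc 6) (p y₀)).symm x))
        (fun _ _ => rfl) ((ht x hx).differentiableAt (by simp)).neg,
        ← chartDeriv_inChart U hx] at h1
      rw [DForm.inChart_two, h1]
      simp }

end Final

/-! ### Global conclusion -/

section Final
open Filter Topology

variable {Y : Type*} [TopologicalSpace Y] [ChartedSpace (Euc 7) Y] [IsManifold 𝓘(ℝ, Euc 7) ∞ Y]
    {N : Type*} [TopologicalSpace N] [ChartedSpace (Euc 6) N] [IsManifold 𝓘(ℝ, Euc 6) ∞ N]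
    {G : G2Structure Y} {V : VField (Euc 7) Y} {p : Y → N}
    {t : N → ℝ} {h : RMetric (Euc 6) N} {J : EndoField (Euc 6) N} {σ : DForm (Euc 6) N 2}
    {U : VField (Euc 6) N}

omit [IsManifold 𝓘(ℝ, Euc 6) ∞ N] in
/-- The horizontal lift of a tangent vector. -/
lemma IsQuotientBy.existsUnique_lift (hp : IsQuotientBy p V) (k : RMetric (Euc 7) Y) (y : Y)
    (u : TangentSpace 𝓘(ℝ, Euc 6) (p y)) :
    ∃! w : TangentSpace 𝓘(ℝ, Euc 7) y, projDeriv p y w = u ∧ k.ip y (V y) w = 0 := by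
  have hk : 0 < k.ip y (V y) (V y) := k.pos _ _ (hp.ne_zero y)
  have hsub : ∀ (c : ℝ) v, k.ip y (V y) (v - c • V y) = k.ip y (V y) v - c * k.ip y (V y) (V y) :=
    fun c v => by
      simp only [RMetric.ip, map_sub, map_smul, smul_eq_mul]
  have hVp : projDeriv p y (V y) = 0 := (hp.kernel y (V y)).2 ⟨1, (one_smul _ _).symm⟩
  obtain ⟨v, hv⟩ := hp.submersion y u
  refine ⟨v - (k.ip y (V y) v / k.ip y (V y) (V y)) • V y, ⟨?_, ?_⟩, ?_⟩
  · rw [← hv]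
    simp only [projDeriv, map_sub, map_smul] at hVp ⊢
    rw [hVp, smul_zero, sub_zero]
  · rw [hsub, div_mul_cancel₀ _ hk.ne', sub_self]
  · rintro w ⟨hw1, hw2⟩
    obtain ⟨c, hc⟩ := (hp.kernel y (v - w)).1 (by
      rw [← hw1] at hv
      simp only [projDeriv, map_sub] at hv ⊢
      rw [hv, sub_self])
    have hw : w = v - c • V y := by rw [← hc, sub_sub_cancel]
    have h1 := hsub c v
    rw [← hw, hw2] at h1
    have h2 : k.ip y (V y) v = c * k.ip y (V y) (V y) := by linarith
    rw [hw, h2, mul_div_cancel_right₀ _ hk.ne']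

lemma IsHorizontalLift.inChart {k : RMetric (Euc 7) Y} {W : VField (Euc 7) Y}
    (hW : IsHorizontalLift k V p U W) (hp : IsQuotientBy p V) {y₀ : Y} {z : Euc 7}
    (hz : z ∈ chartDomain (F := Euc 6) p y₀ (p y₀)) :
    fderiv ℝ (mapInChart (F := Euc 6) p y₀ (p y₀)) z (W.inChart y₀ z)
        = U.inChart (p y₀) (mapInChart p y₀ (p y₀) z) ∧
      k.inChart y₀ z (V.inChart y₀ z) (W.inChart y₀ z) = 0 := by
  obtain ⟨h1, h2⟩ := hW ((extChartAt 𝓘(ℝ, Euc 7) y₀).symm z)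
  constructor
  · have h3 := hp.chartDeriv_proj hz (W.inChart y₀ z)
    rw [chartDeriv_inChart W hz.1] at h3
    exact ((inChart_eq_iff U (mapInChart_mem hz) _).2
      (((U.congr_point (symm_mapInChart hz)).trans h1.symm).trans h3.symm)).symm
  · rw [RMetric.inChart_apply, chartDeriv_inChart V hz.1, chartDeriv_inChart W hz.1, h2]

end Final

end

theorem corollary3
    {Y : Type*} [TopologicalSpace Y] [ChartedSpace (Euc 7) Y] [IsManifold 𝓘(ℝ, Euc 7) ∞ Y]
    {N : Type*} [TopologicalSpace N] [ChartedSpace (Euc 6) N] [IsManifold 𝓘(ℝ, Euc 6) ∞ N]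
    (G : G2Structure Y) (hG : G.TorsionFree)
    (V : VField (Euc 7) Y) (hV : V.Smooth) (hVG : G.IsInfinitesimalAutomorphism V)
    (p : Y → N) (hp : IsQuotientBy p V)
    (t : N → ℝ) (h : RMetric (Euc 6) N) (J : EndoField (Euc 6) N) (σ : DForm (Euc 6) N 2)
    (hind : IsInducedOnQuotient G V p t h σ)
    (hK : IsKaehler h J σ)
    (U : VField (Euc 6) N) (hU : U.Smooth) (hUt : IsHamiltonianField σ (fun n => -t n) U) :
    ∃ W : VField (Euc 7) Y,
      (∀ W' : VField (Euc 7) Y, IsHorizontalLift G.metric V p U W' ↔ W' = W) ∧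
      W.Smooth ∧
      G.IsInfinitesimalAutomorphism W ∧
      G.metric.IsKilling W ∧
      (∀ y, VectorField.mlieBracket 𝓘(ℝ, Euc 7) W V y = 0) ∧
      (∀ y, mfderiv 𝓘(ℝ, Euc 6) 𝓘(ℝ, ℝ) t (p y) ≠ 0 → LinearIndependent ℝ ![V y, W y]) := by
  obtain ⟨W, hWu⟩ : ∃ W : VField (Euc 7) Y, ∀ y, (projDeriv p y (W y) = U (p y) ∧
      G.metric.ip y (V y) (W y) = 0) ∧ ∀ w, projDeriv p y w = U (p y) ∧
        G.metric.ip y (V y) w = 0 → w = W y :=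
    ⟨fun y => (hp.existsUnique_lift G.metric y (U (p y))).choose, fun y =>
      (hp.existsUnique_lift G.metric y (U (p y))).choose_spec⟩
  have hW := fun y => (hWu y).1
  have hWl : IsHorizontalLift G.metric V p U W := hW
  have M := localModel_inChart hG hV hVG hp hind hK hU hUt
  have hflat : ∀ y, ∀ z ∈ chartDomain (F := Euc 6) p y (p y), _ := fun y z hz => hWl.inChart hp hz
  have hmem : ∀ y, extChartAt 𝓘(ℝ, Euc 7) y y ∈ chartDomain (F := Euc 6) p y (p y) := fun y =>
    ⟨mem_extChartAt_target y, by
      rw [Set.mem_preimage, extChartAt_to_inv]; exact mem_extChartAt_source _⟩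
  have hWs : W.Smooth := fun y => smoothAt_of_inChart (mem_extChartAt_source y)
    ((M y).smooth_lift (fun z hz => (hflat y z hz).1) (fun z hz => (hflat y z hz).2) (hmem y))
  have hlie : ∀ y v, flatLie (W.inChart y) (G.phi.inChart y) (extChartAt 𝓘(ℝ, Euc 7) y y) v = 0 :=
    fun y v => (M y).lie_phi_lift (fun z hz => (hflat y z hz).1) (fun z hz => (hflat y z hz).2)
      (hmem y) v
  refine ⟨W, fun W' => ⟨fun h' => funext fun y => (hWu y).2 _ (h' y), fun h' => h' ▸ hWl⟩, hWs,
    ?_, ?_, fun y => ?_, fun y hty => ?_⟩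
  · exact isPreservedBy_of_inChart G.smooth_phi hWs fun y =>
      ⟨y, _, (hmem y).1, extChartAt_to_inv y, hlie y⟩
  · exact isKilling_of_inChart G.metric hWs fun y =>
      ⟨y, _, (hmem y).1, extChartAt_to_inv y, ((M y).lie_metric_chi (hmem y) (hlie y)).1⟩
  · have h1 := (M y).lieBracket_lift (fun z hz => (hflat y z hz).1) (fun z hz => (hflat y z hz).2)
      (hmem y)
    rw [← inChart_mlieBracket (hmem y).1 (hWs _) (hV _), inChart_eq_iff _ (hmem y).1,
      map_zero] at h1
    exact (VField.congr_point (VectorField.mlieBracket 𝓘(ℝ, Euc 7) W V)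
      (extChartAt_to_inv (I := 𝓘(ℝ, Euc 7)) y).symm).trans h1
  · have hk : 0 < G.metric.ip y (V y) (V y) := G.metric.pos _ _ (hp.ne_zero y)
    -- `W y = 0` gives `U = dp(W) = 0` at `p y`, hence `dt = -ι_U σ = 0` there
    have hW0 : W y ≠ 0 := by
      intro h0
      refine hty ?_
      have hU0 : U (p y) = 0 := by
        rw [← (hW y).1, h0]; exact map_zero _
      ext v
      have h1 := hUt (p y) v
      rw [hU0, (σ (p y)).map_coord_zero 0 rfl] at h1
      have h2 : mfderiv 𝓘(ℝ, Euc 6) 𝓘(ℝ, ℝ) (fun n => -t n) (p y)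
          = -mfderiv 𝓘(ℝ, Euc 6) 𝓘(ℝ, ℝ) t (p y) := mfderiv_neg
      rw [dirDeriv, h2] at h1
      exact neg_eq_zero.1 h1.symm
    rw [LinearIndependent.pair_iff]
    intro a b hab
    have h1 : a * G.metric.ip y (V y) (V y) + b * G.metric.ip y (V y) (W y) = 0 := by
      have := congrArg (G.metric.ip y (V y)) hab
      simpa only [RMetric.ip, map_add, map_smul, smul_eq_mul, map_zero] using this
    rw [(hW y).2, mul_zero, add_zero, mul_eq_zero, or_iff_left hk.ne'] at h1
    rw [h1, zero_smul, zero_add, smul_eq_zero, or_iff_left hW0] at hab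
    exact ⟨h1, hab⟩
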